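/- A base station with $N_t$ antennas sends $N$ streams ($1 \le N \le N_t$) with total transmit power $P_T > 0$, equally split over the streams, through a random precoding matrix $\mathbf P \in \mathbb C^{N_t \times N}$ with orthonormal columns. The receiver has $N_r \ge 1$ antennas and noise variance $\sigma^2 > 0$. The channel matrix $\mathbf H \in \mathbb C^{N_r \times N_t}$ is independent of $\mathbf P$ and has i.i.d. circularly symmetric complex Gaussian entries $\mathcal{CN}(0,1)$. Put $\rho = P_T/\sigma^2$. The SINR of beam $n$ at receive antenna $r$ is $$\mathrm{SINR}_{n,r} = \frac{|(\mathbf H \mathbf P)_{r,n}|^2\, P_T/N}{\sigma^2 + \sum_{i \ne n} |(\mathbf H \mathbf P)_{r,i}|^2\, P_T/N},$$ and the downlink coverage probability of the antenna-selection receiver at the threshold $T > 0$ is $P_{AS} = \Pr\{\max_{n,r} \mathrm{SINR}_{n,r} > T\}$. Theorem. If $T \ge 1$, then $$P_{AS} = 1 - \left(1 - \frac{N}{(T+1)^{N-1}}\, e^{-TN/\rho}\right)^{N_r}.$$ If $0 < T < 1$ and $N \ge 2$, then, with $m = \lceil 1/T \rceil$, $$P_{AS} = 1 - \left[1 - \left(P_1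 + \sum_{k=2}^{m-1} P_k + P_m\right)\right]^{N_r},$$ where $$P_1 = \frac{N}{(N-2)!}\left(e^{-TN/\rho} C_1 + C_2\right),$$ $$P_k = \xi_k\!\left(e^{-TN/\rho}\frac{T^l}{l!} D_1 - \frac{1}{(k-1)^l\, l!} D_2\right) + \xi_k\!\left(\frac{1}{k^l\, l!} E_1 - \frac{1}{(k-1)^l\, l!} E_2\right) \quad (2 \le k \le m-1),$$ $$P_m = \xi_m\!\left(e^{-TN/\rho}\frac{T^l}{l!} F_1 - \frac{1}{(m-1)^l\, l!} F_2\right).$$ Here, for $p \ge 1$ and an expression $g_{i,l}$ in the indices $i$ and $l$, $$\xi_p(g_{i,l}) = \frac{N}{(N-2)!}\sum_{t=1}^{p} \binom{N-1}{t-1}(-1)^{t+1} \sum_{i=0}^{N-2}\binom{N-2}{i}(1-t)^i\, i! \sum_{l=0}^{i} g_{i,l}$$ (with $0^0 = 1$ and $\binom{a}{c} = 0$ for $c > a$), $b_k = \dfrac{TN}{\rho(1/k - T)}$ for $1 \le k \le m-1$, and $$C_1 = \frac{(N-2)!}{(T+1)^{N-1}}\left(1 - e^{-(T+1)b_1}\sum_{l=0}^{N-2}\frac{(T+1)^l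 b_1^l}{l!}\right), \qquad C_2 = \frac{(N-2)!}{2^{N-1}} e^{-2b_1}\sum_{l=0}^{N-2}\frac{2^l b_1^l}{l!},$$ $$D_1 = \sum_{v=0}^{l}\binom{l}{v}\left(\frac N\rho\right)^{l-v}\frac{(N-i+v-2)!}{(T+1)^{N-i+v-1}}\sum_{u=0}^{N-i+v-2}\frac{(T+1)^u}{u!}\left(e^{-(T+1)b_{k-1}}b_{k-1}^u - e^{-(T+1)b_k}b_k^u\right),$$ $$D_2 = \frac{(N-i+l-2)!}{\left(\frac{k}{k-1}\right)^{N-i+l-1}}\left[e^{-\frac{k}{k-1}b_{k-1}}\sum_{u=0}^{N-i+l-2}\left(\frac{k}{k-1}\right)^u\frac{b_{k-1}^u}{u!} - e^{-\frac{k}{k-1}b_k}\sum_{u=0}^{N-i+l-2}\left(\frac{k}{k-1}\right)^u\frac{b_k^u}{u!}\right],$$ $$E_1 = \frac{(N-i+l-2)!}{\left(\frac{k+1}{k}\right)^{N-i+l-1}}e^{-\frac{k+1}{k}b_k}\sum_{u=0}^{N-i+l-2}\left(\frac{k+1}{k}\right)^u\frac{b_k^u}{u!},$$ $$E_2 = \frac{(N-i+l-2)!}{\left(\frac{k}{k-1}\right)^{N-i+l-1}}e^{-\frac{k}{k-1}b_k}\sum_{u=0}^{N-i+l-2}\left(\frac{k}{k-1}\right)^u\frac{b_k^u}{u!},$$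 $$F_1 = \sum_{v=0}^{l}\binom{l}{v}\left(\frac N\rho\right)^{l-v}\frac{(N-i+v-2)!}{(T+1)^{N-i+v-1}}e^{-(T+1)b_{m-1}}\sum_{u=0}^{N-i+v-2}(T+1)^u\frac{b_{m-1}^u}{u!},$$ $$F_2 = \frac{(N-i+l-2)!}{\left(\frac{m}{m-1}\right)^{N-i+l-1}}e^{-\frac{m}{m-1}b_{m-1}}\sum_{u=0}^{N-i+l-2}\left(\frac{m}{m-1}\right)^u\frac{b_{m-1}^u}{u!}.$$ -/

import Mathlib

open MeasureTheory ProbabilityTheory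
open scoped NNReal Matrix Nat

noncomputable section

namespace ORP

/-- The circularly symmetric complex Gaussian law `CN(0, v)`: independent real and imaginary
parts, each a centred real Gaussian of variance `v / 2`. -/
def complexGaussian (v : ℝ≥0) : Measure ℂ :=
  ((gaussianReal 0 (v / 2)).prod (gaussianReal 0 (v / 2))).map
    (fun p : ℝ × ℝ => (⟨p.1, p.2⟩ : ℂ))

/-- The SINR of beam `n` at receive antenna `r`, for total transmit power `PT` (equally split
over the `N` beams), noise variance `σ2`, channel matrix `H` and precoding matrix `P`, whose
columns are the beams. The entry `(H * P) r n` is the product of the channel row of antenna `r`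
with the `n`-th beam. -/
def sinr {Nr Nt N : ℕ} (PT σ2 : ℝ) (H : Matrix (Fin Nr) (Fin Nt) ℂ)
    (P : Matrix (Fin Nt) (Fin N) ℂ) (r : Fin Nr) (n : Fin N) : ℝ :=
  (‖(H * P) r n‖ ^ 2 * (PT / N)) /
    (σ2 + ∑ i ∈ Finset.univ.erase n, ‖(H * P) r i‖ ^ 2 * (PT / N))

/-- The maximum SINR over all receive antennas and all beams. -/
def maxSinr {Nr Nt N : ℕ} (PT σ2 : ℝ) (H : Matrix (Fin Nr) (Fin Nt) ℂ)
    (P : Matrix (Fin Nt) (Fin N) ℂ) : ℝ :=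
  ⨆ q : Fin Nr × Fin N, sinr PT σ2 H P q.1 q.2

/-- The downlink coverage probability with antenna selection: the probability that the maximum
SINR exceeds the threshold `T`. -/
def coverageProb {Ω : Type*} [MeasurableSpace Ω] (μ : Measure Ω) {Nr Nt N : ℕ} (PT σ2 : ℝ)
    (H : Ω → Matrix (Fin Nr) (Fin Nt) ℂ) (P : Ω → Matrix (Fin Nt) (Fin N) ℂ) (T : ℝ) : ℝ :=
  μ.real {ω | T < maxSinr PT σ2 (H ω) (P ω)}

/-- `b_k = T N / (ρ (1/k - T))`. -/
def b (N : ℕ) (ρ T : ℝ) (k : ℕ) : ℝ := T * N / (ρ * (1 / k - T))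

/-- The summation operator `ξ_p`, applied to an expression `g` in the indices `i` and `l`. -/
def xi (N p : ℕ) (g : ℕ → ℕ → ℝ) : ℝ :=
  (N : ℝ) / ((N - 2)! : ℕ) *
    ∑ t ∈ Finset.Icc 1 p, ((N - 1).choose (t - 1) : ℝ) * (-1) ^ (t + 1) *
      ∑ i ∈ Finset.range (N - 2 + 1), ((N - 2).choose i : ℝ) * (1 - (t : ℝ)) ^ i * (i ! : ℕ) *
        ∑ l ∈ Finset.range (i + 1), g i l

def C₁ (N : ℕ) (ρ T : ℝ) : ℝ :=
  ((N - 2)! : ℕ) / (T + 1) ^ (N - 1) *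
    (1 - Real.exp (-(T + 1) * b N ρ T 1) *
      ∑ l ∈ Finset.range (N - 2 + 1), (T + 1) ^ l * b N ρ T 1 ^ l / (l ! : ℕ))

def C₂ (N : ℕ) (ρ T : ℝ) : ℝ :=
  ((N - 2)! : ℕ) / 2 ^ (N - 1) * Real.exp (-2 * b N ρ T 1) *
    ∑ l ∈ Finset.range (N - 2 + 1), 2 ^ l * b N ρ T 1 ^ l / (l ! : ℕ)

def D₁ (N : ℕ) (ρ T : ℝ) (k i l : ℕ) : ℝ :=
  ∑ v ∈ Finset.range (l + 1),
    (l.choose v : ℝ) * ((N : ℝ) / ρ) ^ (l - v) *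
      (((N - i + v - 2)! : ℕ) / (T + 1) ^ (N - i + v - 1)) *
      ∑ u ∈ Finset.range (N - i + v - 2 + 1),
        (T + 1) ^ u / (u ! : ℕ) *
          (Real.exp (-(T + 1) * b N ρ T (k - 1)) * b N ρ T (k - 1) ^ u -
            Real.exp (-(T + 1) * b N ρ T k) * b N ρ T k ^ u)

def D₂ (N : ℕ) (ρ T : ℝ) (k i l : ℕ) : ℝ :=
  ((N - i + l - 2)! : ℕ) / ((k : ℝ) / ((k : ℝ) - 1)) ^ (N - i + l - 1) *
    (Real.exp (-((k : ℝ) / ((k : ℝ) - 1)) * b N ρ T (k - 1)) *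
        ∑ u ∈ Finset.range (N - i + l - 2 + 1),
          ((k : ℝ) / ((k : ℝ) - 1)) ^ u * (b N ρ T (k - 1) ^ u / (u ! : ℕ)) -
      Real.exp (-((k : ℝ) / ((k : ℝ) - 1)) * b N ρ T k) *
        ∑ u ∈ Finset.range (N - i + l - 2 + 1),
          ((k : ℝ) / ((k : ℝ) - 1)) ^ u * (b N ρ T k ^ u / (u ! : ℕ)))

def E₁ (N : ℕ) (ρ T : ℝ) (k i l : ℕ) : ℝ :=
  ((N - i + l - 2)! : ℕ) / (((k : ℝ) + 1) / k) ^ (N - i + l - 1) *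
    Real.exp (-(((k : ℝ) + 1) / k) * b N ρ T k) *
    ∑ u ∈ Finset.range (N - i + l - 2 + 1),
      (((k : ℝ) + 1) / k) ^ u * (b N ρ T k ^ u / (u ! : ℕ))

def E₂ (N : ℕ) (ρ T : ℝ) (k i l : ℕ) : ℝ :=
  ((N - i + l - 2)! : ℕ) / ((k : ℝ) / ((k : ℝ) - 1)) ^ (N - i + l - 1) *
    Real.exp (-((k : ℝ) / ((k : ℝ) - 1)) * b N ρ T k) *
    ∑ u ∈ Finset.range (N - i + l - 2 + 1),
      ((k : ℝ) / ((k : ℝ) - 1)) ^ u * (b N ρ T k ^ u / (u ! : ℕ))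

def F₁ (N : ℕ) (ρ T : ℝ) (m i l : ℕ) : ℝ :=
  ∑ v ∈ Finset.range (l + 1),
    (l.choose v : ℝ) * ((N : ℝ) / ρ) ^ (l - v) *
      (((N - i + v - 2)! : ℕ) / (T + 1) ^ (N - i + v - 1)) *
      Real.exp (-(T + 1) * b N ρ T (m - 1)) *
      ∑ u ∈ Finset.range (N - i + v - 2 + 1),
        (T + 1) ^ u * (b N ρ T (m - 1) ^ u / (u ! : ℕ))

def F₂ (N : ℕ) (ρ T : ℝ) (m i l : ℕ) : ℝ :=
  ((N - i + l - 2)! : ℕ) / ((m : ℝ) / ((m : ℝ) - 1)) ^ (N - i + l - 1) *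
    Real.exp (-((m : ℝ) / ((m : ℝ) - 1)) * b N ρ T (m - 1)) *
    ∑ u ∈ Finset.range (N - i + l - 2 + 1),
      ((m : ℝ) / ((m : ℝ) - 1)) ^ u * (b N ρ T (m - 1) ^ u / (u ! : ℕ))

/-- The first summand of the single-antenna coverage probability for `T < 1`. -/
def pFirst (N : ℕ) (ρ T : ℝ) : ℝ :=
  (N : ℝ) / ((N - 2)! : ℕ) * (Real.exp (-(T * N / ρ)) * C₁ N ρ T + C₂ N ρ T)

/-- The `k`-th summand, `2 ≤ k ≤ m - 1`. -/
def pMid (N : ℕ) (ρ T : ℝ) (k : ℕ) : ℝ :=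
  xi N k (fun i l =>
      Real.exp (-(T * N / ρ)) * (T ^ l / (l ! : ℕ)) * D₁ N ρ T k i l -
        1 / (((k : ℝ) - 1) ^ l * (l ! : ℕ)) * D₂ N ρ T k i l) +
    xi N k (fun i l =>
      1 / ((k : ℝ) ^ l * (l ! : ℕ)) * E₁ N ρ T k i l -
        1 / (((k : ℝ) - 1) ^ l * (l ! : ℕ)) * E₂ N ρ T k i l)

/-- The last summand. -/
def pLast (N : ℕ) (ρ T : ℝ) (m : ℕ) : ℝ :=
  xi N m (fun i l =>
    Real.exp (-(T * N / ρ)) * (T ^ l / (l ! : ℕ)) * F₁ N ρ T m i l -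
      1 / (((m : ℝ) - 1) ^ l * (l ! : ℕ)) * F₂ N ρ T m i l)

/-- The single-antenna expression for `T ≥ 1`. -/
def pHigh (N : ℕ) (ρ T : ℝ) : ℝ :=
  (N : ℝ) / (T + 1) ^ (N - 1) * Real.exp (-(T * N / ρ))

/-- The single-antenna expression for `0 < T < 1`, with `m = ⌈1 / T⌉`. -/
def pLow (N : ℕ) (ρ T : ℝ) : ℝ :=
  pFirst N ρ T + ∑ k ∈ Finset.Icc 2 (⌈1 / T⌉₊ - 1), pMid N ρ T k + pLast N ρ T ⌈1 / T⌉₊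

end ORP

end

/-!
The argument has a probabilistic half, which reduces the coverage probability to a computation
with independent exponential variables, and an analytic half, which evaluates the latter.

For a fixed precoder with orthonormal columns, right multiplication maps a matrix with i.i.d.
`CN(0, 1)` entries to another one, since both characteristic functions are `exp (-‖t‖² / 4)`
(`map_mulRight`). As the precoder is independent of the channel, the entries of `H * P` are
i.i.d. `CN(0, 1)` (`hasLaw_mul_precoder`), and their squared moduli are i.i.d. standard exponential
(`map_normSq_complexGaussian`). The receive antennas are therefore independent, and the coverage
probability is `1 - (1 - q) ^ Nr`, where `q` is the probability that `N` independent exponential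
variables `x` satisfy `T (c + ∑_{i ≠ n} x i) < x n` for some `n`, with `c = N / ρ`
(`coverageProb_eq`).

If `T ≥ 1`, these events are disjoint for different `n` and `q` is a sum of `N` equal Laplace
transforms (`pi_coverSet_of_one_le`).

If `T < 1`, some beam exceeds the threshold if and only if the strongest one does. Let `x` be the
power of the strongest of the `N = n + 2` beams and `y` the sum of the other powers. Given `x`, the
other variables are restricted to `[0, x]`, and inclusion–exclusion gives the density of their sum
as an alternating sum of truncated powers `(y - t x)₊ ^ n` (`lintegral_bounded_sum`). So `q` is the
integral of an explicit density over the region `T (c + y) < x`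
(`pi_coverSet_eq_lintegral`). This region is cut into the strips `k x < y ≤ (k + 1) x`. In each of
them the density is a polynomial times `exp (-x - y)`, and only the first `⌈1 / T⌉` strips meet the
region (`pi_coverSet_eq_sum_stripMoment`). Integrating over `x` first, the limits of integration
change at the numbers `b_k`, and all the integrals are incomplete Gamma integrals
(`stripMoment_zero`, `stripMoment_mid`, `stripMoment_last`). The strips give the successive
summands of the formula (`pi_coverSet_of_lt_one`).
-/

noncomputable section

namespace ORP

/-! ### Gaussian matrices times a matrix with orthonormal columns -/

lemma measurable_complexMk : Measurable fun p : ℝ × ℝ => (⟨p.1, p.2⟩ : ℂ) :=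
  Complex.measurableEquivRealProd.symm.measurable

instance (v : ℝ≥0) : IsProbabilityMeasure (complexGaussian v) :=
  Measure.isProbabilityMeasure_map measurable_complexMk.aemeasurable

/-- The characteristic function of `CN(0, 1)`; it depends on the modulus only. -/
lemma charFun_complexGaussian (s : ℂ) :
    charFun (complexGaussian 1) s = Complex.exp (-((‖s‖ ^ 2 / 4 : ℝ) : ℂ)) := by
  have h1 : charFun (complexGaussian 1) s =
      charFun (gaussianReal 0 (1 / 2)) s.re * charFun (gaussianReal 0 (1 / 2)) s.im := by
    rw [charFun_apply_real, charFun_apply_real, ← integral_prod_mul, charFun_apply,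
      complexGaussian, integral_map measurable_complexMk.aemeasurable]
    · congr 1
      ext p
      rw [← Complex.exp_add]
      congr 1
      rw [Complex.inner]
      simp
      ring
    · refine Measurable.aestronglyMeasurable ?_
      fun_prop
  rw [h1, charFun_gaussianReal, charFun_gaussianReal, ← Complex.exp_add]
  congr 1
  rw [← Complex.normSq_eq_norm_sq, Complex.normSq_apply]
  push_cast
  ring

/-- Right multiplication by `pᴴ` preserves the Euclidean norm of every row. -/
lemma sum_normSq_row_mul_conjTranspose {Nr Nt N : ℕ} (t : Matrix (Fin Nr) (Fin N) ℂ)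
    {p : Matrix (Fin Nt) (Fin N) ℂ} (hp : pᴴ * p = 1) (r : Fin Nr) :
    ∑ j, ‖(t * pᴴ) r j‖ ^ 2 = ∑ n, ‖t r n‖ ^ 2 := by
  have key : ∀ {M : ℕ} (A : Matrix (Fin Nr) (Fin M) ℂ),
      (A * Aᴴ) r r = ((∑ j, ‖A r j‖ ^ 2 : ℝ) : ℂ) := by
    intro M A
    rw [Matrix.mul_apply]
    push_cast
    refine Finset.sum_congr rfl fun j _ => ?_
    rw [Matrix.conjTranspose_apply]
    exact Complex.mul_conj' _
  have h : (t * pᴴ) * (t * pᴴ)ᴴ = t * tᴴ := by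
    rw [Matrix.conjTranspose_mul, Matrix.conjTranspose_conjTranspose, Matrix.mul_assoc,
      ← Matrix.mul_assoc pᴴ, hp, Matrix.one_mul]
  have h2 := key (t * pᴴ)
  rw [h, key t] at h2
  exact_mod_cast h2.symm

/-- Right multiplication by `p`, on matrices stored as functions on pairs of indices, so that a
matrix with i.i.d. entries has a single product measure as its law. -/
def mulRight {Nr Nt N : ℕ} (p : Fin Nt × Fin N → ℂ) (h : Fin Nr × Fin Nt → ℂ) :
    Fin Nr × Fin N → ℂ :=
  fun q => ∑ j, h (q.1, j) * p (j, q.2)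

lemma measurable_mulRight_uncurry {Nr Nt N : ℕ} :
    Measurable (Function.uncurry (mulRight (Nr := Nr) (Nt := Nt) (N := N))) := by
  unfold mulRight Function.uncurry
  fun_prop

/-- The adjoint of right multiplication by `p` is right multiplication by `pᴴ`. -/
lemma inner_mulRight {Nr Nt N : ℕ} (p : Matrix (Fin Nt) (Fin N) ℂ) (h : Fin Nr × Fin Nt → ℂ)
    (t : Matrix (Fin Nr) (Fin N) ℂ) :
    ∑ q : Fin Nr × Fin N, inner ℝ (mulRight (fun a => p a.1 a.2) h q) (t q.1 q.2) =
      ∑ q : Fin Nr × Fin Nt, inner ℝ (h q) ((t * pᴴ) q.1 q.2) := by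
  simp only [Fintype.sum_prod_type, mulRight, sum_inner]
  refine Finset.sum_congr rfl fun r _ => ?_
  rw [Finset.sum_comm]
  refine Finset.sum_congr rfl fun j _ => ?_
  rw [Matrix.mul_apply, inner_sum]
  refine Finset.sum_congr rfl fun n _ => ?_
  simp only [Complex.inner, Matrix.conjTranspose_apply, Complex.star_def, map_mul]
  congr 1
  ring

/-- The law of a matrix with i.i.d. `CN(0, 1)` entries is invariant under right multiplication by a
matrix with orthonormal columns: both characteristic functions are `exp (-‖t‖² / 4)`. -/
lemma map_mulRight {Nr Nt N : ℕ} {p : Matrix (Fin Nt) (Fin N) ℂ} (hp : pᴴ * p = 1) :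
    (Measure.pi fun _ : Fin Nr × Fin Nt => complexGaussian 1).map
      (mulRight fun a => p a.1 a.2) = Measure.pi fun _ : Fin Nr × Fin N => complexGaussian 1 := by
  have hm : Measurable (mulRight (Nr := Nr) fun a : Fin Nt × Fin N => p a.1 a.2) :=
    measurable_mulRight_uncurry.of_uncurry_left
  have : IsProbabilityMeasure ((Measure.pi fun _ : Fin Nr × Fin Nt => complexGaussian 1).map
      (mulRight fun a => p a.1 a.2)) := Measure.isProbabilityMeasure_map hm.aemeasurable
  refine charFun_eq_pi_iff.1 fun t => ?_
  let t' : Matrix (Fin Nr) (Fin N) ℂ := fun r n => t (r, n)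
  let s : PiLp 2 fun _ : Fin Nr × Fin Nt => ℂ := WithLp.toLp 2 fun q => (t' * pᴴ) q.1 q.2
  have h1 : charFun (((Measure.pi fun _ : Fin Nr × Fin Nt => complexGaussian 1).map
      (mulRight fun a => p a.1 a.2)).map (WithLp.toLp 2)) t =
      charFun ((Measure.pi fun _ : Fin Nr × Fin Nt => complexGaussian 1).map
        (WithLp.toLp 2)) s := by
    rw [charFun_apply, charFun_apply, Measure.map_map (by fun_prop) hm,
      ← MeasurableEquiv.coe_toLp, ← MeasurableEquiv.coe_toLp, integral_map_equiv, integral_map]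
    · refine integral_congr_ae (.of_forall fun h => ?_)
      have := inner_mulRight p h t'
      simp only [PiLp.inner_apply, Function.comp, MeasurableEquiv.coe_toLp]
      congr 3
    · fun_prop
    · refine Measurable.aestronglyMeasurable ?_
      fun_prop
  rw [h1, charFun_pi]
  simp only [charFun_complexGaussian]
  rw [← Complex.exp_sum, ← Complex.exp_sum]
  congr 1
  simp only [Finset.sum_neg_distrib, ← Complex.ofReal_sum, ← Finset.sum_div]
  congr 3
  simp only [Fintype.sum_prod_type]
  exact Finset.sum_congr rfl fun r _ => sum_normSq_row_mul_conjTranspose t' hp r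

/-- For a random precoder independent of the channel, the entries of `H * P` are again i.i.d.
`CN(0, 1)`: this holds conditionally on `P`. -/
lemma hasLaw_mul_precoder {Ω : Type*} [MeasurableSpace Ω] {μ : Measure Ω} [IsProbabilityMeasure μ]
    {Nr Nt N : ℕ} {H : Ω → Matrix (Fin Nr) (Fin Nt) ℂ} {P : Ω → Matrix (Fin Nt) (Fin N) ℂ}
    (hHlaw : ∀ r j, HasLaw (fun ω => H ω r j) (complexGaussian 1) μ)
    (hHindep : iIndepFun (fun (q : Fin Nr × Fin Nt) ω => H ω q.1 q.2) μ)
    (hPmeas : ∀ j n, AEMeasurable (fun ω => P ω j n) μ)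
    (hPorth : ∀ᵐ ω ∂μ, (P ω)ᴴ * P ω = 1)
    (hHP : IndepFun (fun ω (q : Fin Nr × Fin Nt) => H ω q.1 q.2)
      (fun ω (q : Fin Nt × Fin N) => P ω q.1 q.2) μ) :
    HasLaw (fun ω (q : Fin Nr × Fin N) => (H ω * P ω) q.1 q.2)
      (Measure.pi fun _ => complexGaussian 1) μ := by
  have hH := iIndepFun.hasLaw_pi (μ := fun _ => complexGaussian 1)
    (fun q : Fin Nr × Fin Nt => hHlaw q.1 q.2) hHindep
  have hPm : AEMeasurable (fun ω (q : Fin Nt × Fin N) => P ω q.1 q.2) μ :=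
    aemeasurable_pi_lambda _ fun q => hPmeas q.1 q.2
  have hP : HasLaw (fun ω (q : Fin Nt × Fin N) => P ω q.1 q.2)
      (μ.map fun ω (q : Fin Nt × Fin N) => P ω q.1 q.2) μ := ⟨hPm, rfl⟩
  have : IsProbabilityMeasure (μ.map fun ω (q : Fin Nt × Fin N) => P ω q.1 q.2) :=
    Measure.isProbabilityMeasure_map hPm
  have hjoint := hHP.symm.hasLaw_prod hP hH
  -- The law of the precoder is concentrated on a measurable set, where `map_mulRight` applies.
  have hset : MeasurableSet {p : Fin Nt × Fin N → ℂ |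
      (Matrix.of fun j n => p (j, n))ᴴ * (Matrix.of fun j n => p (j, n)) = 1} := by
    have : {p : Fin Nt × Fin N → ℂ |
      (Matrix.of fun j n => p (j, n))ᴴ * (Matrix.of fun j n => p (j, n)) = 1} =
        ⋂ a : Fin N, ⋂ b : Fin N, {p | ∑ j, star (p (j, a)) * p (j, b) =
          (1 : Matrix (Fin N) (Fin N) ℂ) a b} := by
      ext p
      simp [← Matrix.ext_iff, Matrix.mul_apply]
    rw [this]
    refine MeasurableSet.iInter fun a => MeasurableSet.iInter fun b => ?_
    refine measurableSet_eq_fun ?_ (by fun_prop)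
    fun_prop
  have hskew :=
    (MeasurePreserving.id (μ.map fun ω (q : Fin Nt × Fin N) => P ω q.1 q.2)).skew_product
    (μc := Measure.pi fun _ : Fin Nr × Fin Nt => complexGaussian 1)
    (μd := Measure.pi fun _ : Fin Nr × Fin N => complexGaussian 1)
    (g := mulRight) measurable_mulRight_uncurry (by
      filter_upwards [(ae_map_iff hPm hset).2 hPorth] with p hp using map_mulRight hp)
  have := (measurePreserving_snd.comp hskew).comp_hasLaw hjoint
  refine this.congr (.of_forall fun ω => ?_)
  ext q
  simp [mulRight, Matrix.mul_apply]

/-! ### The exponential law of the squared modulus -/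

/-- The standard exponential law. -/
abbrev stdExp : Measure ℝ := expMeasure 1

instance : IsProbabilityMeasure stdExp := isProbabilityMeasure_expMeasure one_pos

lemma lintegral_stdExp {f : ℝ → ENNReal} (hf : Measurable f) :
    ∫⁻ x, f x ∂stdExp = ∫⁻ x in Set.Ioi 0, ENNReal.ofReal (Real.exp (-x)) * f x := by
  have h : stdExp = volume.withDensity (exponentialPDF 1) := rfl
  rw [h, lintegral_withDensity_eq_lintegral_mul _ (by unfold exponentialPDF; fun_prop) hf,
    ← lintegral_indicator measurableSet_Ioi]
  refine lintegral_congr_ae ?_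
  filter_upwards [Measure.ae_ne volume (0 : ℝ)] with x hx
  rw [Pi.mul_apply, exponentialPDF_eq]
  rcases lt_or_gt_of_ne hx with h | h
  · simp [h.not_ge, h.le]
  · simp [h.le, h]

lemma ae_stdExp_pos : ∀ᵐ x ∂stdExp, 0 < x := by
  rw [ae_iff, ← lintegral_indicator_one (by measurability), lintegral_stdExp]
  · rw [setLIntegral_congr_fun (g := 0) measurableSet_Ioi]
    · simp
    · intro x hx
      simp_all
  · exact measurable_one.indicator (by measurability)

instance : NullSingletonClass stdExp := by
  have h : stdExp = volume.withDensity (exponentialPDF 1) := rfl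
  rw [h]
  infer_instance

/-- Tail of the exponential law. -/
lemma stdExp_Ioi {a : ℝ} (ha : 0 ≤ a) : stdExp (Set.Ioi a) = ENNReal.ofReal (Real.exp (-a)) := by
  rw [← lintegral_indicator_one measurableSet_Ioi,
    lintegral_stdExp (measurable_one.indicator measurableSet_Ioi)]
  have : ∀ x : ℝ, ENNReal.ofReal (Real.exp (-x)) * (Set.Ioi a).indicator 1 x =
      (Set.Ioi a).indicator (fun x => ENNReal.ofReal (Real.exp (-x))) x := by
    intro x
    by_cases hx : x ∈ Set.Ioi a <;> simp [hx]
  simp_rw [this]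
  rw [setLIntegral_indicator measurableSet_Ioi, Set.inter_eq_left.2 (Set.Ioi_subset_Ioi ha),
    ← ofReal_integral_eq_lintegral_ofReal (integrableOn_exp_neg_Ioi a)
      (.of_forall fun x => (Real.exp_pos _).le), integral_exp_neg_Ioi]

lemma gaussianPDF_half (x : ℝ) : gaussianPDF 0 (1 / 2) x =
    ENNReal.ofReal ((√Real.pi)⁻¹ * Real.exp (-x ^ 2)) := by
  rw [gaussianPDF, gaussianPDFReal]
  congr 3
  · simp
    field_simp
  · simp

/-- The squared modulus of a `CN(0, 1)` variable is standard exponential: polar coordinates. -/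
lemma map_normSq_complexGaussian :
    (complexGaussian 1).map (fun z => ‖z‖ ^ 2) = stdExp := by
  refine Measure.ext_of_lintegral _ fun f hf => ?_
  have hfn : Measurable fun p : ℝ × ℝ => f (p.1 ^ 2 + p.2 ^ 2) := by fun_prop
  have hnorm : ∀ p : ℝ × ℝ, ‖(⟨p.1, p.2⟩ : ℂ)‖ ^ 2 = p.1 ^ 2 + p.2 ^ 2 := fun p => by
    rw [← Complex.normSq_eq_norm_sq, Complex.normSq_apply]
    ring
  rw [lintegral_map hf (by fun_prop), complexGaussian, lintegral_map (by fun_prop)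
    measurable_complexMk, gaussianReal_of_var_ne_zero _ (by simp),
    prod_withDensity (measurable_gaussianPDF _ _) (measurable_gaussianPDF _ _),
    lintegral_withDensity_eq_lintegral_mul _ (by fun_prop) (by simpa only [hnorm] using hfn),
    ← Measure.volume_eq_prod, ← lintegral_comp_polarCoord_symm, lintegral_stdExp hf]
  -- The radial integral of the Gaussian density becomes exponential under `x = r ^ 2`.
  have hsub : ∫⁻ x in Set.Ioi (0 : ℝ), ENNReal.ofReal (Real.exp (-x)) * f x =
      ∫⁻ r in Set.Ioi (0 : ℝ), ENNReal.ofReal (2 * r) *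
        (ENNReal.ofReal (Real.exp (-r ^ 2)) * f (r ^ 2)) := by
    have himg : (fun r : ℝ => r ^ 2) '' Set.Ioi 0 = Set.Ioi 0 := by
      ext y
      constructor
      · rintro ⟨x, hx, rfl⟩
        exact pow_pos (Set.mem_Ioi.1 hx) 2
      · intro hy
        exact ⟨√y, Real.sqrt_pos.2 hy, Real.sq_sqrt (Set.mem_Ioi.1 hy).le⟩
    have hinj : Set.InjOn (fun r : ℝ => r ^ 2) (Set.Ioi 0) := fun a ha b hb hab =>
      (pow_left_inj₀ (Set.mem_Ioi.1 ha).le (Set.mem_Ioi.1 hb).le two_ne_zero).1 hab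
    conv_lhs => rw [← himg]
    rw [lintegral_image_eq_lintegral_abs_deriv_mul measurableSet_Ioi (f' := fun r => 2 * r)
      (fun x _ => by simpa using (hasDerivAt_pow 2 x).hasDerivWithinAt) hinj]
    refine setLIntegral_congr_fun measurableSet_Ioi fun r hr => ?_
    have : 0 < r := hr
    simp only [abs_of_pos (mul_pos two_pos this)]
  rw [hsub, polarCoord_target, Measure.volume_eq_prod, setLIntegral_prod]
  · refine setLIntegral_congr_fun measurableSet_Ioi fun r hr => ?_
    have hr0 : 0 < r := hr
    have : ∀ θ : ℝ, (ENNReal.ofReal r • ((fun z : ℝ × ℝ => gaussianPDF 0 (1 / 2) z.1 *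
        gaussianPDF 0 (1 / 2) z.2) * fun a : ℝ × ℝ => f (‖(⟨a.1, a.2⟩ : ℂ)‖ ^ 2))
          (polarCoord.symm (r, θ))) =
        ENNReal.ofReal (r * (Real.pi⁻¹ * Real.exp (-r ^ 2))) * f (r ^ 2) := by
      intro θ
      simp only [Pi.mul_apply, hnorm, polarCoord_symm_apply, gaussianPDF_half, smul_eq_mul]
      rw [← ENNReal.ofReal_mul (by positivity), ← mul_assoc, ← ENNReal.ofReal_mul hr0.le]
      have e1 : (r * Real.cos θ) ^ 2 + (r * Real.sin θ) ^ 2 = r ^ 2 := by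
        linear_combination r ^ 2 * Real.cos_sq_add_sin_sq θ
      rw [e1]
      congr 3
      rw [← e1, neg_add, Real.exp_add, ← Real.mul_self_sqrt Real.pi_pos.le, mul_inv]
      simp
      ring
    have hvol : volume (Set.Ioo (-Real.pi) Real.pi) = ENNReal.ofReal (2 * Real.pi) := by
      rw [Real.volume_Ioo]
      ring_nf
    refine (setLIntegral_congr_fun measurableSet_Ioo fun θ _ => this θ).trans ?_
    rw [setLIntegral_const, hvol, mul_right_comm, ← ENNReal.ofReal_mul (by positivity),
      ← mul_assoc (ENNReal.ofReal (2 * r)), ← ENNReal.ofReal_mul (by positivity)]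
    congr 2
    field_simp
  · refine Measurable.aemeasurable ?_
    have h1 : Measurable fun p : ℝ × ℝ => polarCoord.symm p :=
      continuous_polarCoord_symm.measurable
    have h2 : Measurable ((fun z : ℝ × ℝ => gaussianPDF 0 (1 / 2) z.1 *
        gaussianPDF 0 (1 / 2) z.2) * fun a : ℝ × ℝ => f (‖(⟨a.1, a.2⟩ : ℂ)‖ ^ 2)) := by
      simp only [hnorm]
      exact Measurable.mul (by fun_prop) hfn
    exact (by fun_prop : Measurable fun p : ℝ × ℝ => ENNReal.ofReal p.1).smul (h2.comp h1)

/-! ### Reduction to one antenna, and thresholds at least one -/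

/-- The set of vectors of beam powers for which some beam has SINR above `T`; `c` is the noise
power in units of the power of one stream. -/
def coverSet (N : ℕ) (c T : ℝ) : Set (Fin N → ℝ) :=
  {x | ∃ n, T * (c + ∑ i ∈ Finset.univ.erase n, x i) < x n}

lemma measurableSet_coverSet (N : ℕ) (c T : ℝ) : MeasurableSet (coverSet N c T) := by
  have : coverSet N c T = ⋃ n, {x | T * (c + ∑ i ∈ Finset.univ.erase n, x i) < x n} := by
    ext x
    simp [coverSet]
  rw [this]
  exact MeasurableSet.iUnion fun n => measurableSet_lt (by fun_prop) (by fun_prop)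

lemma lt_sinr_iff {Nr Nt N : ℕ} (hN : 1 ≤ N) {PT σ2 T : ℝ} (hPT : 0 < PT) (hσ2 : 0 < σ2)
    (H : Matrix (Fin Nr) (Fin Nt) ℂ) (P : Matrix (Fin Nt) (Fin N) ℂ) (r : Fin Nr) (n : Fin N) :
    T < sinr PT σ2 H P r n ↔
      T * (N / (PT / σ2) + ∑ i ∈ Finset.univ.erase n, ‖(H * P) r i‖ ^ 2) < ‖(H * P) r n‖ ^ 2 := by
  have hN' : (0 : ℝ) < N := by exact_mod_cast hN
  have hp : 0 < PT / N := div_pos hPT hN'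
  have hsum : 0 ≤ ∑ i ∈ Finset.univ.erase n, ‖(H * P) r i‖ ^ 2 * (PT / N) :=
    Finset.sum_nonneg fun i _ => by positivity
  have hσ : σ2 = N / (PT / σ2) * (PT / N) := by field_simp
  have hfac : T * (σ2 + ∑ i ∈ Finset.univ.erase n, ‖(H * P) r i‖ ^ 2 * (PT / N)) =
      T * (N / (PT / σ2) + ∑ i ∈ Finset.univ.erase n, ‖(H * P) r i‖ ^ 2) * (PT / N) := by
    rw [← Finset.sum_mul]
    nth_rewrite 1 [hσ]
    ring
  rw [sinr, lt_div_iff₀ (by positivity), hfac, mul_lt_mul_iff_of_pos_right hp]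

lemma lt_maxSinr_iff {Nr Nt N : ℕ} (hNr : 1 ≤ Nr) (hN : 1 ≤ N) {PT σ2 T : ℝ} (hPT : 0 < PT)
    (hσ2 : 0 < σ2) (H : Matrix (Fin Nr) (Fin Nt) ℂ) (P : Matrix (Fin Nt) (Fin N) ℂ) :
    T < maxSinr PT σ2 H P ↔
      ∃ r, (fun n => ‖(H * P) r n‖ ^ 2) ∈ coverSet N (N / (PT / σ2)) T := by
  have : Nonempty (Fin Nr × Fin N) := ⟨(⟨0, hNr⟩, ⟨0, hN⟩)⟩
  rw [maxSinr, lt_ciSup_iff (Set.finite_range _).bddAbove, Prod.exists]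
  simp only [lt_sinr_iff hN hPT hσ2]
  rfl

/-- The rows of the effective channel are independent, so that the coverage probability reduces to
the probability `q` that a single antenna is covered, as `1 - (1 - q) ^ Nr`. -/
lemma coverageProb_eq {Ω : Type*} [MeasurableSpace Ω] {μ : Measure Ω} [IsProbabilityMeasure μ]
    {Nr Nt N : ℕ} (hNr : 1 ≤ Nr) (hN : 1 ≤ N)
    {PT σ2 : ℝ} (T : ℝ) (hPT : 0 < PT) (hσ2 : 0 < σ2)
    {H : Ω → Matrix (Fin Nr) (Fin Nt) ℂ} {P : Ω → Matrix (Fin Nt) (Fin N) ℂ}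
    (hlaw : HasLaw (fun ω (q : Fin Nr × Fin N) => (H ω * P ω) q.1 q.2)
      (Measure.pi fun _ => complexGaussian 1) μ) :
    coverageProb μ PT σ2 H P T =
      1 - (1 - (Measure.pi fun _ : Fin N => stdExp).real (coverSet N (N / (PT / σ2)) T)) ^ Nr := by
  have hsq : MeasurePreserving (fun (w : Fin Nr × Fin N → ℂ) q => ‖w q‖ ^ 2)
      (Measure.pi fun _ => complexGaussian 1) (Measure.pi fun _ => stdExp) :=
    measurePreserving_pi _ _ fun _ => ⟨by fun_prop, map_normSq_complexGaussian⟩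
  -- Regrouping the entries by rows exhibits the law as a product over the antennas.
  have hcurry : MeasurePreserving (MeasurableEquiv.curry (Fin Nr) (Fin N) ℝ)
      (Measure.pi fun _ => stdExp) (Measure.pi fun _ => Measure.pi fun _ => stdExp) := by
    refine ⟨by fun_prop, ?_⟩
    have := Measure.infinitePi_map_curry (fun (_ : Fin Nr) (_ : Fin N) => stdExp)
    simpa only [Measure.infinitePi_eq_pi] using this
  have hrow := (hcurry.comp hsq).comp_hasLaw hlaw
  set S := coverSet N (N / (PT / σ2)) T
  have hS : MeasurableSet S := measurableSet_coverSet _ _ _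
  have hcompl : {ω | T < maxSinr PT σ2 (H ω) (P ω)} =
      (fun ω => ((MeasurableEquiv.curry (Fin Nr) (Fin N) ℝ) ∘
        fun (w : Fin Nr × Fin N → ℂ) q => ‖w q‖ ^ 2) fun q => (H ω * P ω) q.1 q.2) ⁻¹'
        (Set.univ.pi fun _ => Sᶜ)ᶜ := by
    ext ω
    rw [Set.mem_ofPred_eq, lt_maxSinr_iff hNr hN hPT hσ2]
    simp only [Set.mem_preimage, Set.mem_compl_iff, Set.mem_univ_pi, not_forall, not_not]
    rfl
  have hmeas : MeasurableSet (Set.univ.pi fun _ : Fin Nr => Sᶜ) :=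
    MeasurableSet.univ_pi fun _ => hS.compl
  rw [coverageProb, hcompl]
  have : μ.real ((fun ω => ((MeasurableEquiv.curry (Fin Nr) (Fin N) ℝ) ∘
        fun (w : Fin Nr × Fin N → ℂ) q => ‖w q‖ ^ 2) fun q => (H ω * P ω) q.1 q.2) ⁻¹'
        (Set.univ.pi fun _ => Sᶜ)ᶜ) = (Measure.pi fun _ : Fin Nr => Measure.pi fun _ : Fin N =>
          stdExp).real (Set.univ.pi fun _ => Sᶜ)ᶜ := by
    rw [← hrow.map_eq, measureReal_def, measureReal_def,
      Measure.map_apply_of_aemeasurable hrow.aemeasurable hmeas.compl]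
    rfl
  rw [this, probReal_compl_eq_one_sub hmeas, measureReal_def, Measure.pi_pi, ENNReal.toReal_prod]
  congr 1
  simp only [Finset.prod_const, Finset.card_univ, Fintype.card_fin]
  rw [← measureReal_def, probReal_compl_eq_one_sub hS]

/-- Splits off one coordinate of the product measure from all the others. -/
lemma pi_stdExp_split {N : ℕ} (n : Fin (N + 1)) {S : Set (Fin (N + 1) → ℝ)}
    (A : Set (ℝ × (Fin N → ℝ))) (hA : MeasurableSet A)
    (h : ∀ x, x ∈ S ↔ (x n, fun j => x (n.succAbove j)) ∈ A) :
    (Measure.pi fun _ : Fin (N + 1) => stdExp) S =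
      (stdExp.prod (Measure.pi fun _ : Fin N => stdExp)) A := by
  have := measurePreserving_piFinSuccAbove (fun _ : Fin (N + 1) => stdExp) n
  rw [← this.measure_preimage hA.nullMeasurableSet]
  congr 1
  ext x
  rw [h]
  rfl

lemma sum_erase_eq_sum_succAbove {N : ℕ} (n : Fin (N + 1)) (x : Fin (N + 1) → ℝ) :
    ∑ i ∈ Finset.univ.erase n, x i = ∑ j, x (n.succAbove j) := by
  have h := Fin.sum_univ_succAbove x n
  rw [← Finset.add_sum_erase _ _ (Finset.mem_univ n)] at h
  linarith

lemma ae_pi_stdExp_pos (N : ℕ) : ∀ᵐ x ∂(Measure.pi fun _ : Fin N => stdExp), ∀ i, 0 < x i :=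
  eventually_countable_forall.2 fun i =>
    (measurePreserving_eval (fun _ : Fin N => stdExp) i).quasiMeasurePreserving.ae ae_stdExp_pos

lemma lintegral_exp_neg_mul_stdExp {T : ℝ} (hT : 0 ≤ T) :
    ∫⁻ x, ENNReal.ofReal (Real.exp (-(T * x))) ∂stdExp = ENNReal.ofReal (1 / (T + 1)) := by
  have hlt : -(T + 1) < 0 := by linarith
  rw [lintegral_stdExp (by fun_prop)]
  simp_rw [← ENNReal.ofReal_mul (Real.exp_pos _).le, ← Real.exp_add]
  have : ∀ x : ℝ, -x + -(T * x) = -(T + 1) * x := fun x => by ring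
  simp_rw [this]
  rw [← ofReal_integral_eq_lintegral_ofReal (integrableOn_exp_mul_Ioi hlt 0)
    (.of_forall fun x => (Real.exp_pos _).le), integral_exp_mul_Ioi hlt]
  congr 1
  rw [mul_zero, Real.exp_zero, neg_div_neg_eq]

lemma integrable_exp_neg_mul_stdExp {T : ℝ} (hT : 0 ≤ T) :
    Integrable (fun x => Real.exp (-(T * x))) stdExp := by
  rw [← lintegral_ofReal_ne_top_iff_integrable (by fun_prop)
    (.of_forall fun x => (Real.exp_pos _).le), lintegral_exp_neg_mul_stdExp hT]
  exact ENNReal.ofReal_ne_top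

lemma integral_exp_neg_mul_stdExp {T : ℝ} (hT : 0 ≤ T) :
    ∫ x, Real.exp (-(T * x)) ∂stdExp = 1 / (T + 1) := by
  rw [integral_eq_lintegral_of_nonneg_ae (.of_forall fun x => (Real.exp_pos _).le) (by fun_prop),
    lintegral_exp_neg_mul_stdExp hT, ENNReal.toReal_ofReal (by positivity)]

/-- For `T ≥ 1` at most one beam exceeds the threshold, and each does so with probability
`exp (-T c) / (T + 1) ^ (N - 1)`. -/
lemma pi_coverSet_of_one_le (N : ℕ) {c T : ℝ} (hc : 0 < c) (hT : 1 ≤ T) :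
    (Measure.pi fun _ : Fin (N + 1) => stdExp).real (coverSet (N + 1) c T) =
      (N + 1) / (T + 1) ^ N * Real.exp (-(T * c)) := by
  set A : Fin (N + 1) → Set (Fin (N + 1) → ℝ) := fun n =>
    {x | T * (c + ∑ i ∈ Finset.univ.erase n, x i) < x n}
  have hA : ∀ n, MeasurableSet (A n) := fun n => measurableSet_lt (by fun_prop) (by fun_prop)
  have hU : coverSet (N + 1) c T = ⋃ n, A n := by
    ext x
    simp [coverSet, A]
  have hdisj : Pairwise (Function.onFun (AEDisjoint (Measure.pi fun _ : Fin (N + 1) => stdExp))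
      A) := by
    intro a b hab
    refine measure_mono_null (t := {x | ¬ ∀ i, 0 < x i}) ?_ (ae_pi_stdExp_pos (N + 1))
    rintro x ⟨ha, hb⟩ hpos
    have key : ∀ a b : Fin (N + 1), a ≠ b → x ∈ A a → x b < x a := by
      intro a b hab ha
      have h1 : x b ≤ ∑ i ∈ Finset.univ.erase a, x i :=
        Finset.single_le_sum (f := x) (fun i _ => (hpos i).le)
          (Finset.mem_erase.2 ⟨hab.symm, Finset.mem_univ _⟩)
      have h2 : T * (c + ∑ i ∈ Finset.univ.erase a, x i) < x a := ha
      have h3 := hpos b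
      nlinarith
    exact lt_asymm (key a b hab ha) (key b a hab.symm hb)
  have hone : ∀ n, (Measure.pi fun _ : Fin (N + 1) => stdExp) (A n) =
      ENNReal.ofReal (1 / (T + 1) ^ N * Real.exp (-(T * c))) := by
    intro n
    have hm : MeasurableSet {p : ℝ × (Fin N → ℝ) | T * (c + ∑ j, p.2 j) < p.1} :=
      measurableSet_lt (by fun_prop) (by fun_prop)
    rw [pi_stdExp_split n {p | T * (c + ∑ j, p.2 j) < p.1} hm (fun x => by
      simp only [A, Set.mem_ofPred_eq, sum_erase_eq_sum_succAbove]),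
      Measure.prod_apply_symm hm]
    have h1 : ∀ᵐ u ∂(Measure.pi fun _ : Fin N => stdExp),
        stdExp ((fun x => (x, u)) ⁻¹' {p : ℝ × (Fin N → ℝ) | T * (c + ∑ j, p.2 j) < p.1}) =
          ENNReal.ofReal (Real.exp (-(T * c)) * ∏ j, Real.exp (-(T * u j))) := by
      filter_upwards [ae_pi_stdExp_pos N] with u hu
      have hs : 0 ≤ ∑ j, u j := Finset.sum_nonneg fun j _ => (hu j).le
      refine (stdExp_Ioi (a := T * (c + ∑ j, u j)) (by positivity)).trans ?_
      rw [← Real.exp_sum, ← Real.exp_add, Finset.sum_neg_distrib, ← Finset.mul_sum]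
      ring_nf
    have hi : Integrable (fun u : Fin N → ℝ => ∏ j, Real.exp (-(T * u j)))
        (Measure.pi fun _ => stdExp) :=
      Integrable.fintype_prod fun _ => integrable_exp_neg_mul_stdExp (zero_le_one.trans hT)
    -- Given the other powers, the tail probability is a product of Laplace transform kernels.
    rw [lintegral_congr_ae h1, ← ofReal_integral_eq_lintegral_ofReal (hi.const_mul _)
      (.of_forall fun u => by positivity), integral_const_mul,
      integral_fintype_prod_eq_pow fun x => Real.exp (-(T * x)),
      integral_exp_neg_mul_stdExp (zero_le_one.trans hT), Fintype.card_fin, one_div_pow, mul_comm]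
  rw [measureReal_def, hU, measure_iUnion₀ hdisj fun n => (hA n).nullMeasurableSet, tsum_fintype]
  simp only [hone, Finset.sum_const, Finset.card_univ, Fintype.card_fin, nsmul_eq_mul]
  rw [ENNReal.toReal_mul, ENNReal.toReal_ofReal (by positivity), ENNReal.toReal_natCast]
  push_cast
  ring

/-! ### Sums of bounded exponential variables -/

/-- The truncated power `y₊ ^ n`. The value at `n = 0` is the indicator of `y > 0`. -/
def posPow (n : ℕ) (y : ℝ) : ℝ := if 0 < y then y ^ n else 0

lemma posPow_of_pos (n : ℕ) {y : ℝ} (hy : 0 < y) : posPow n y = y ^ n := if_pos hy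

lemma posPow_of_nonpos (n : ℕ) {y : ℝ} (hy : y ≤ 0) : posPow n y = 0 := if_neg hy.not_gt

lemma monotone_posPow (n : ℕ) : Monotone (posPow n) := by
  intro a b hab
  rcases lt_or_ge 0 a with ha | ha
  · rw [posPow_of_pos n ha, posPow_of_pos n (ha.trans_le hab)]
    gcongr
  · rw [posPow_of_nonpos n ha, posPow]
    split_ifs with hb
    · exact (pow_pos hb n).le
    · exact le_rfl

@[fun_prop]
lemma measurable_posPow (n : ℕ) : Measurable (posPow n) := (monotone_posPow n).measurable

lemma posPow_succ_eq (n : ℕ) (y : ℝ) : posPow (n + 1) y = max y 0 ^ (n + 1) := by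
  rcases lt_or_ge 0 y with hy | hy
  · rw [posPow_of_pos _ hy, max_eq_left hy.le]
  · rw [posPow_of_nonpos _ hy, max_eq_right hy, zero_pow n.succ_ne_zero]

/-- The fundamental theorem of calculus applies off the countable set `{0}`, where `posPow 1` has a
kink. -/
lemma integral_posPow (n : ℕ) (a b : ℝ) :
    ∫ u in a..b, posPow n u = (posPow (n + 1) b - posPow (n + 1) a) / (n + 1) := by
  have hc : Continuous (posPow (n + 1)) := by
    have : posPow (n + 1) = fun y => max y 0 ^ (n + 1) := funext (posPow_succ_eq n)
    rw [this]
    fun_prop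
  have h := integral_eq_of_hasDerivAt_off_countable (posPow (n + 1))
    (fun u => (n + 1) * posPow n u) (a := a) (b := b) (Set.countable_singleton 0)
    hc.continuousOn (fun x hx => by
      have hx0 : x ≠ 0 := hx.2
      rcases lt_or_gt_of_ne hx0 with h | h
      · rw [posPow_of_nonpos n h.le, mul_zero]
        refine (hasDerivAt_const x (0 : ℝ)).congr_of_eventuallyEq ?_
        filter_upwards [gt_mem_nhds h] with y hy using posPow_of_nonpos _ (le_of_lt hy)
      · rw [posPow_of_pos n h]
        have := hasDerivAt_pow (n + 1) x
        simp only [Nat.add_sub_cancel, Nat.cast_add, Nat.cast_one] at this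
        refine this.congr_of_eventuallyEq ?_
        filter_upwards [lt_mem_nhds h] with y hy using posPow_of_pos _ hy)
    ((monotone_posPow n).intervalIntegrable.const_mul _)
  rw [intervalIntegral.integral_const_mul] at h
  rw [← h]
  field_simp

/-- `exp (-y)` times this is the density, at `y`, of the sum of `n + 1` independent standard
exponential variables restricted to the event that none exceeds `x`: inclusion–exclusion over the
set of variables that do exceed `x`. -/
def boundedSumDensity (n : ℕ) (x y : ℝ) : ℝ :=
  (∑ t ∈ Finset.range (n + 2), (-1) ^ t * ((n + 1).choose t : ℝ) * posPow n (y - t * x)) / n !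

@[fun_prop]
lemma measurable_boundedSumDensity (n : ℕ) :
    Measurable (Function.uncurry (boundedSumDensity n)) := by
  unfold boundedSumDensity Function.uncurry
  fun_prop

/-- Pascal's rule, in the form of summation by parts. -/
lemma sum_choose_succ_mul (N : ℕ) (p : ℕ → ℝ) :
    ∑ t ∈ Finset.range (N + 2), (-1) ^ t * ((N + 1).choose t : ℝ) * p t =
      ∑ t ∈ Finset.range (N + 1), (-1) ^ t * (N.choose t : ℝ) * (p t - p (t + 1)) := by
  have h1 : ∑ t ∈ Finset.range (N + 1), (-1) ^ t * (N.choose t : ℝ) * p t =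
      ∑ t ∈ Finset.range (N + 1), (-1) ^ (t + 1) * (N.choose (t + 1) : ℝ) * p (t + 1) + p 0 := by
    have h2 := Finset.sum_range_succ (fun t => (-1) ^ t * (N.choose t : ℝ) * p t) (N + 1)
    rw [Finset.sum_range_succ'] at h2
    simpa using h2.symm
  rw [Finset.sum_range_succ']
  simp only [Nat.choose_succ_succ, mul_sub, Finset.sum_sub_distrib]
  rw [h1]
  simp only [Nat.choose_zero_right, pow_zero, Nat.cast_one, one_mul, Nat.cast_add]
  rw [add_sub_right_comm, ← Finset.sum_sub_distrib]
  congr 1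
  refine Finset.sum_congr rfl fun t _ => ?_
  ring

/-- Convolution with the indicator function of `(0, x]` raises the number of summands by one. -/
lemma integral_boundedSumDensity (n : ℕ) (x z : ℝ) :
    ∫ u in (0 : ℝ)..x, boundedSumDensity n x (z - u) = boundedSumDensity (n + 1) x z := by
  have h1 : ∀ t : ℕ, ∫ u in (0 : ℝ)..x, posPow n (z - u - t * x) =
      (posPow (n + 1) (z - t * x) - posPow (n + 1) (z - (t + 1 : ℕ) * x)) / (n + 1) := by
    intro t
    have : ∀ u, z - u - t * x = (z - t * x) - u := fun u => by ring
    simp_rw [this]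
    rw [intervalIntegral.integral_comp_sub_left (posPow n), integral_posPow]
    congr 3
    · ring
    · push_cast
      ring
  unfold boundedSumDensity
  rw [intervalIntegral.integral_div, intervalIntegral.integral_finsetSum, sum_choose_succ_mul]
  · simp_rw [intervalIntegral.integral_const_mul, h1]
    rw [Nat.factorial_succ, Finset.sum_div, Finset.sum_div]
    refine Finset.sum_congr rfl fun t _ => ?_
    push_cast
    field_simp
  · intro t _
    refine IntervalIntegrable.const_mul ?_ _
    refine Antitone.intervalIntegrable fun a b hab => monotone_posPow n ?_
    linarith

/-- The defining sum alternates; its sign is read off from the convolution formula. -/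
lemma boundedSumDensity_nonneg (n : ℕ) {x : ℝ} (hx : 0 ≤ x) (y : ℝ) :
    0 ≤ boundedSumDensity n x y := by
  induction n generalizing y with
  | zero =>
    have := monotone_posPow 0 (sub_le_self y hx)
    simp [boundedSumDensity, Finset.sum_range_succ]
    linarith
  | succ n ih =>
    rw [← integral_boundedSumDensity]
    exact intervalIntegral.integral_nonneg hx fun u _ => ih _

lemma intervalIntegrable_boundedSumDensity (n : ℕ) (x z a b : ℝ) :
    IntervalIntegrable (fun u => boundedSumDensity n x (z - u)) volume a b := by
  unfold boundedSumDensity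
  refine IntervalIntegrable.div_const ?_ _
  have h := IntervalIntegrable.sum (μ := volume) (a := a) (b := b) (Finset.range (n + 2))
    (f := fun (t : ℕ) u => (-1) ^ t * ((n + 1).choose t : ℝ) * posPow n (z - u - t * x))
    fun t _ => IntervalIntegrable.const_mul (Antitone.intervalIntegrable fun a b hab =>
      monotone_posPow n (by linarith)) _
  rwa [Finset.sum_fn] at h

lemma lintegral_boundedSumDensity (n : ℕ) {x : ℝ} (hx : 0 ≤ x) (z : ℝ) :
    ∫⁻ u in Set.Ioc 0 x, ENNReal.ofReal (boundedSumDensity n x (z - u)) =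
      ENNReal.ofReal (boundedSumDensity (n + 1) x z) := by
  rw [← ofReal_integral_eq_lintegral_ofReal
    ((intervalIntegrable_iff_integrableOn_Ioc_of_le hx).1
      (intervalIntegrable_boundedSumDensity n x z 0 x))
    (.of_forall fun u => boundedSumDensity_nonneg n hx _),
    ← intervalIntegral.integral_of_le hx, integral_boundedSumDensity]

/-- The law of the sum of `n + 1` independent standard exponential variables on the event that none
of them exceeds `x`. -/
lemma lintegral_bounded_sum (n : ℕ) {x : ℝ} (hx : 0 < x) {F : ℝ → ENNReal} (hF : Measurable F) :
    ∫⁻ u, {u : Fin (n + 1) → ℝ | ∀ j, u j ≤ x}.indicator (fun u => F (∑ j, u j)) u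
        ∂(Measure.pi fun _ => stdExp) =
      ∫⁻ y, F y * ENNReal.ofReal (Real.exp (-y) * boundedSumDensity n x y) := by
  have hmeas : ∀ N : ℕ, MeasurableSet {u : Fin N → ℝ | ∀ j, u j ≤ x} := fun N => by
    rw [Set.ofPred_forall]
    exact MeasurableSet.iInter fun j => measurableSet_le (by fun_prop) (by fun_prop)
  induction n generalizing F with
  | zero =>
    have h := measurePreserving_funUnique stdExp (Fin 1)
    have hm : Measurable ((Set.Iic x).indicator F) := hF.indicator measurableSet_Iic
    have e : ∀ u : Fin 1 → ℝ, {u : Fin 1 → ℝ | ∀ j, u j ≤ x}.indicator (fun u => F (∑ j, u j)) u =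
        (Set.Iic x).indicator F (MeasurableEquiv.funUnique (Fin 1) ℝ u) := by
      intro u
      simp [Set.indicator_apply]
    simp_rw [e]
    refine (h.lintegral_comp hm).trans ?_
    rw [lintegral_stdExp hm, ← lintegral_indicator measurableSet_Ioi]
    refine lintegral_congr_ae ?_
    filter_upwards [Measure.ae_ne volume x] with y hy
    have hg : boundedSumDensity 0 x y = (Set.Ioc 0 x).indicator 1 y := by
      simp only [boundedSumDensity, Finset.sum_range_succ, posPow, Set.indicator_apply, Set.mem_Ioc]
      rcases lt_or_ge 0 y with h0 | h0
      · rcases lt_or_gt_of_ne hy with h1 | h1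
        · simp [h0, h1.le]
        · simp [h0, h1, h1.not_ge]
      · simp [h0.not_gt, (h0.trans hx.le).not_gt]
    rw [hg]
    by_cases h0 : 0 < y <;> by_cases h1 : y ≤ x <;> simp [h0, h1, mul_comm]
  | succ n ih =>
    -- Integrate over the first variable `a` last; the induction hypothesis is applied to
    -- `F (a + ·)`, and the substitution `z = a + y` turns the sum into a convolution.
    have h := measurePreserving_piFinSuccAbove (fun _ : Fin (n + 2) => stdExp) 0
    have e : ∀ u : Fin (n + 2) → ℝ,
        {u : Fin (n + 2) → ℝ | ∀ j, u j ≤ x}.indicator (fun u => F (∑ j, u j)) u =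
        (fun p : ℝ × (Fin (n + 1) → ℝ) => (Set.Iic x ×ˢ {u | ∀ j, u j ≤ x}).indicator
          (fun p : ℝ × (Fin (n + 1) → ℝ) => F (p.1 + ∑ j, p.2 j)) p)
          (MeasurableEquiv.piFinSuccAbove (fun _ : Fin (n + 2) => ℝ) 0 u) := by
      intro u
      simp [Set.indicator_apply, Fin.forall_fin_succ, Fin.sum_univ_succ, Fin.tail]
    have hm : Measurable (fun p : ℝ × (Fin (n + 1) → ℝ) =>
        (Set.Iic x ×ˢ {u | ∀ j, u j ≤ x}).indicator
          (fun p : ℝ × (Fin (n + 1) → ℝ) => F (p.1 + ∑ j, p.2 j)) p) :=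
      Measurable.indicator (by fun_prop) (measurableSet_Iic.prod (hmeas _))
    simp_rw [e]
    refine (h.lintegral_comp hm).trans ?_
    rw [lintegral_prod _ hm.aemeasurable]
    have h1 : ∀ a : ℝ, ∫⁻ u, (Set.Iic x ×ˢ {u : Fin (n + 1) → ℝ | ∀ j, u j ≤ x}).indicator
          (fun p : ℝ × (Fin (n + 1) → ℝ) => F (p.1 + ∑ j, p.2 j)) (a, u)
          ∂(Measure.pi fun _ => stdExp) =
        (Set.Iic x).indicator (fun a => ∫⁻ z, F z *
          ENNReal.ofReal (Real.exp (-(z - a)) * boundedSumDensity n x (z - a))) a := by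
      intro a
      by_cases ha : a ≤ x
      · have := ih (F := fun s => F (a + s)) (by fun_prop)
        rw [Set.indicator_of_mem (Set.mem_Iic.2 ha)]
        rw [← lintegral_add_left_eq_self _ a]
        simp only [add_sub_cancel_left]
        rw [← this]
        refine lintegral_congr fun u => ?_
        simp [Set.indicator_apply, ha]
      · simp [ha]
    simp_rw [h1]
    have hm2 : Measurable (Function.uncurry fun a z : ℝ => F z *
        ENNReal.ofReal (Real.exp (-(z - a)) * boundedSumDensity n x (z - a))) := by
      unfold Function.uncurry boundedSumDensity
      fun_prop
    have hm3 : Measurable fun a => ∫⁻ z, F z *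
        ENNReal.ofReal (Real.exp (-(z - a)) * boundedSumDensity n x (z - a)) :=
      hm2.lintegral_prod_right'
    rw [lintegral_stdExp (hm3.indicator measurableSet_Iic)]
    have h2 : ∀ a : ℝ, ENNReal.ofReal (Real.exp (-a)) * (Set.Iic x).indicator (fun a => ∫⁻ z, F z *
          ENNReal.ofReal (Real.exp (-(z - a)) * boundedSumDensity n x (z - a))) a =
        (Set.Iic x).indicator (fun a => ∫⁻ z, F z * ENNReal.ofReal (Real.exp (-z)) *
          ENNReal.ofReal (boundedSumDensity n x (z - a))) a := by
      intro a
      by_cases ha : a ≤ x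
      · rw [Set.indicator_of_mem (Set.mem_Iic.2 ha), Set.indicator_of_mem (Set.mem_Iic.2 ha),
          ← lintegral_const_mul _ hm2.of_uncurry_left]
        refine lintegral_congr fun z => ?_
        rw [mul_left_comm, ← ENNReal.ofReal_mul (Real.exp_pos _).le, ← mul_assoc, ← Real.exp_add,
          ENNReal.ofReal_mul (Real.exp_pos _).le, ← mul_assoc]
        congr 4
        ring
      · simp [ha]
    simp_rw [h2]
    rw [setLIntegral_indicator measurableSet_Iic, Set.inter_comm, Set.Ioi_inter_Iic,
      lintegral_lintegral_swap (by
        unfold Function.uncurry boundedSumDensity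
        exact Measurable.aemeasurable (by fun_prop))]
    refine lintegral_congr fun z => ?_
    rw [lintegral_const_mul _ (by unfold boundedSumDensity; fun_prop),
      lintegral_boundedSumDensity n hx.le, ENNReal.ofReal_mul (Real.exp_pos _).le, mul_assoc]

/-! ### The strongest beam -/

/-- Two beams almost surely have different powers. -/
lemma pi_stdExp_tie {N : ℕ} {a b : Fin (N + 1)} (hab : a ≠ b) :
    (Measure.pi fun _ : Fin (N + 1) => stdExp) {x | x a = x b} = 0 := by
  obtain ⟨j, rfl⟩ := Fin.exists_succAbove_eq hab.symm
  have hm : MeasurableSet {p : ℝ × (Fin N → ℝ) | p.1 = p.2 j} :=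
    measurableSet_eq_fun (by fun_prop) (by fun_prop)
  rw [pi_stdExp_split (S := {x | x a = x (a.succAbove j)}) a {p | p.1 = p.2 j} hm
    fun x => Iff.rfl, Measure.prod_apply_symm hm]
  simp

/-- If some beam exceeds the threshold then so does the strongest one, which is almost surely
unique; each of the `n + 2` beams is equally likely to be it. The integration variables are the
power `p.1` of the strongest beam and the total power `p.2` of the others. -/
lemma pi_coverSet_eq_lintegral (n : ℕ) {c T : ℝ} (hc : 0 < c) (hT : 0 < T) :
    (Measure.pi fun _ : Fin (n + 2) => stdExp) (coverSet (n + 2) c T) =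
      (n + 2 : ℕ) * ∫⁻ p in {p : ℝ × ℝ | 0 < p.2 ∧ T * (c + p.2) < p.1},
        ENNReal.ofReal (Real.exp (-(p.1 + p.2)) * boundedSumDensity n p.1 p.2) := by
  set π := Measure.pi fun _ : Fin (n + 2) => stdExp
  set A : Fin (n + 2) → Set (Fin (n + 2) → ℝ) := fun k =>
    {x | T * (c + ∑ i ∈ Finset.univ.erase k, x i) < x k ∧ ∀ j, x (k.succAbove j) ≤ x k}
  set B : Set (ℝ × (Fin (n + 1) → ℝ)) := {p | T * (c + ∑ j, p.2 j) < p.1 ∧ ∀ j, p.2 j ≤ p.1}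
  have hB : MeasurableSet B := by
    simp only [B, Set.ofPred_and, Set.ofPred_forall]
    refine (measurableSet_lt (by fun_prop) (by fun_prop)).inter ?_
    exact MeasurableSet.iInter fun j => measurableSet_le (by fun_prop) (by fun_prop)
  have hA : ∀ k, MeasurableSet (A k) := fun k => by
    simp only [A, Set.ofPred_and, Set.ofPred_forall]
    refine (measurableSet_lt (by fun_prop) (by fun_prop)).inter ?_
    exact MeasurableSet.iInter fun j => measurableSet_le (by fun_prop) (by fun_prop)
  have hU : coverSet (n + 2) c T = ⋃ k, A k := by
    ext x
    simp only [coverSet, A, Set.mem_iUnion, Set.mem_ofPred_eq]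
    constructor
    · -- Replacing the beam by the strongest one raises its power and lowers the interference.
      rintro ⟨k, hk⟩
      obtain ⟨l, hl⟩ := Finite.exists_max x
      refine ⟨l, ?_, fun j => hl _⟩
      have h1 := Finset.add_sum_erase Finset.univ x (Finset.mem_univ k)
      have h2 := Finset.add_sum_erase Finset.univ x (Finset.mem_univ l)
      have h3 := hl k
      have : ∑ i ∈ Finset.univ.erase l, x i ≤ ∑ i ∈ Finset.univ.erase k, x i := by linarith
      calc _ ≤ T * (c + ∑ i ∈ Finset.univ.erase k, x i) := by gcongr
        _ < x k := hk
        _ ≤ x l := h3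
    · rintro ⟨k, hk, -⟩
      exact ⟨k, hk⟩
  have hdisj : Pairwise (Function.onFun (AEDisjoint π) A) := by
    intro a b hab
    refine measure_mono_null ?_ (pi_stdExp_tie hab)
    rintro x ⟨⟨-, ha⟩, ⟨-, hb⟩⟩
    obtain ⟨j, hj⟩ := Fin.exists_succAbove_eq hab
    obtain ⟨j', hj'⟩ := Fin.exists_succAbove_eq hab.symm
    exact le_antisymm (hj ▸ hb j) (hj' ▸ ha j')
  have hone : ∀ k, π (A k) = (stdExp.prod (Measure.pi fun _ : Fin (n + 1) => stdExp)) B := by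
    intro k
    refine pi_stdExp_split k B hB fun x => ?_
    simp only [A, B, Set.mem_ofPred_eq, sum_erase_eq_sum_succAbove]
  rw [hU, measure_iUnion₀ hdisj fun k => (hA k).nullMeasurableSet, tsum_fintype]
  simp only [hone, Finset.sum_const, Finset.card_univ, Fintype.card_fin, nsmul_eq_mul]
  congr 1
  rw [Measure.prod_apply hB, lintegral_stdExp (measurable_measure_prodMk_left hB)]
  set f : ℝ × ℝ → ENNReal := fun p =>
    ENNReal.ofReal (Real.exp (-(p.1 + p.2)) * boundedSumDensity n p.1 p.2)
  have hf : Measurable f := by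
    have := measurable_boundedSumDensity n
    simp only [f]
    exact (Measurable.mul (by fun_prop) this).ennreal_ofReal
  have hR : MeasurableSet {p : ℝ × ℝ | 0 < p.2 ∧ T * (c + p.2) < p.1} := by
    rw [Set.ofPred_and]
    exact (measurableSet_lt (by fun_prop) (by fun_prop)).inter
      (measurableSet_lt (by fun_prop) (by fun_prop))
  rw [← lintegral_indicator hR, Measure.volume_eq_prod,
    lintegral_prod _ (hf.indicator hR).aemeasurable, ← lintegral_indicator measurableSet_Ioi]
  refine lintegral_congr fun x => ?_
  by_cases hx : x ∈ Set.Ioi (0 : ℝ)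
  · have hx0 : 0 < x := hx
    rw [Set.indicator_of_mem hx]
    have hF : Measurable ({y : ℝ | T * (c + y) < x}.indicator (1 : ℝ → ENNReal)) :=
      measurable_one.indicator (measurableSet_lt (by fun_prop) (by fun_prop))
    have h1 := lintegral_bounded_sum n hx0 hF
    have h2 : (Measure.pi fun _ : Fin (n + 1) => stdExp) (Prod.mk x ⁻¹' B) =
        ∫⁻ u, {u : Fin (n + 1) → ℝ | ∀ j, u j ≤ x}.indicator
          (fun u => {y : ℝ | T * (c + y) < x}.indicator (1 : ℝ → ENNReal) (∑ j, u j)) u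
          ∂(Measure.pi fun _ => stdExp) := by
      rw [← lintegral_indicator_one (hB.preimage measurable_prodMk_left)]
      refine lintegral_congr fun u => ?_
      by_cases h3 : ∀ j, u j ≤ x <;> by_cases h4 : T * (c + ∑ j, u j) < x <;>
        simp [Set.indicator_apply, B, h3, h4]
    rw [h2, h1, ← lintegral_const_mul _ (by
      refine hF.mul ?_
      exact (Measurable.mul (by fun_prop)
        (measurable_boundedSumDensity n).of_uncurry_left).ennreal_ofReal)]
    refine lintegral_congr fun y => ?_
    by_cases hy : 0 < y
    · by_cases h4 : T * (c + y) < x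
      · simp only [Set.indicator_apply, Set.mem_ofPred_eq, h4, hy, if_true, Pi.one_apply, one_mul,
          and_self, f]
        rw [← ENNReal.ofReal_mul (Real.exp_pos _).le, ← mul_assoc, ← Real.exp_add, neg_add]
      · simp [h4]
    · have hg : boundedSumDensity n x y = 0 := by
        rw [boundedSumDensity, Finset.sum_eq_zero, zero_div]
        intro t _
        have : 0 ≤ (t : ℝ) * x := by positivity
        rw [posPow_of_nonpos n (by linarith), mul_zero]
      simp [hg, hy]
  · rw [Set.indicator_of_notMem hx, lintegral_eq_zero_of_ae_eq_zero]
    refine .of_forall fun y => Set.indicator_of_notMem ?_ _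
    rintro ⟨hy, hxy⟩
    refine hx (lt_trans ?_ hxy)
    exact mul_pos hT (add_pos hc hy)

/-! ### Incomplete Gamma integrals -/

/-- `∫_a^∞ x ^ i * exp (-L * x) dx`, in closed form. -/
def expTail (i : ℕ) (L a : ℝ) : ℝ :=
  (i ! : ℕ) / L ^ (i + 1) * Real.exp (-L * a) *
    ∑ u ∈ Finset.range (i + 1), L ^ u * (a ^ u / (u ! : ℕ))

lemma expTail_succ (i : ℕ) {L : ℝ} (hL : 0 < L) (a : ℝ) :
    expTail (i + 1) L a =
      (i + 1) / L * expTail i L a + a ^ (i + 1) * Real.exp (-L * a) / L := by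
  unfold expTail
  rw [Finset.sum_range_succ, Nat.factorial_succ]
  have : ((i ! : ℕ) : ℝ) ≠ 0 := by positivity
  push_cast
  field_simp
  ring

lemma hasDerivAt_expTail (i : ℕ) {L : ℝ} (hL : 0 < L) (a : ℝ) :
    HasDerivAt (expTail i L) (-(a ^ i * Real.exp (-L * a))) a := by
  have he : HasDerivAt (fun a => Real.exp (-L * a)) (Real.exp (-L * a) * -L) a := by
    simpa using ((hasDerivAt_id a).const_mul (-L)).exp
  induction i with
  | zero =>
    have : expTail 0 L = fun a => 1 / L * Real.exp (-L * a) := by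
      ext a
      simp [expTail]
    rw [this]
    refine (he.const_mul (1 / L)).congr_deriv ?_
    field_simp
  | succ i ih =>
    rw [funext (expTail_succ i hL)]
    refine ((ih.const_mul _).add (((hasDerivAt_pow (i + 1) a).mul he).div_const L)).congr_deriv ?_
    field_simp
    push_cast
    ring

lemma tendsto_expTail (i : ℕ) {L : ℝ} (hL : 0 < L) :
    Filter.Tendsto (expTail i L) Filter.atTop (nhds 0) := by
  have h : ∀ k : ℕ, Filter.Tendsto (fun a : ℝ => a ^ k * Real.exp (-L * a)) Filter.atTop
      (nhds 0) := fun k => by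
    simpa using tendsto_rpow_mul_exp_neg_mul_atTop_nhds_zero (k : ℝ) L hL
  induction i with
  | zero =>
    have : expTail 0 L = fun a => 1 / L * (a ^ 0 * Real.exp (-L * a)) := by
      ext a
      simp [expTail]
    rw [this]
    simpa using (h 0).const_mul (1 / L)
  | succ i ih =>
    rw [funext (expTail_succ i hL)]
    simpa using (ih.const_mul ((i + 1) / L)).add ((h (i + 1)).div_const L)

/-- `F` is the tail integral of `f` on the half-lines contained in `[0, ∞)`. -/
def HasTail (f F : ℝ → ℝ) : Prop :=
  ∀ a, 0 ≤ a → IntegrableOn f (Set.Ioi a) ∧ ∫ x in Set.Ioi a, f x = F a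

namespace HasTail

variable {f g F G : ℝ → ℝ}

lemma congr (h : HasTail f F) (hfg : ∀ x, 0 < x → g x = f x) : HasTail g F := fun a ha => by
  have : Set.EqOn g f (Set.Ioi a) := fun x hx => hfg x (ha.trans_lt hx)
  exact ⟨(h a ha).1.congr_fun this.symm measurableSet_Ioi,
    (setIntegral_congr_fun measurableSet_Ioi this).trans (h a ha).2⟩

lemma const_mul (h : HasTail f F) (C : ℝ) : HasTail (fun x => C * f x) fun a => C * F a :=
  fun a ha => ⟨(h a ha).1.const_mul C, by rw [integral_const_mul, (h a ha).2]⟩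

lemma sub (h : HasTail f F) (h' : HasTail g G) :
    HasTail (fun x => f x - g x) fun a => F a - G a :=
  fun a ha => ⟨(h a ha).1.sub (h' a ha).1, by
    rw [integral_sub (h a ha).1 (h' a ha).1, (h a ha).2, (h' a ha).2]⟩

lemma sum {ι : Type*} (s : Finset ι) {f F : ι → ℝ → ℝ} (h : ∀ i ∈ s, HasTail (f i) (F i)) :
    HasTail (fun x => ∑ i ∈ s, f i x) fun a => ∑ i ∈ s, F i a :=
  fun a ha => ⟨integrable_finsetSum s fun i hi => (h i hi a ha).1, by
    rw [integral_finsetSum s fun i hi => (h i hi a ha).1]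
    exact Finset.sum_congr rfl fun i hi => (h i hi a ha).2⟩

lemma integral_Ioc (h : HasTail f F) {a b : ℝ} (ha : 0 ≤ a) (hab : a ≤ b) :
    ∫ x in Set.Ioc a b, f x = F a - F b := by
  have h1 : IntegrableOn f (Set.Ioc a b) := (h a ha).1.mono_set Set.Ioc_subset_Ioi_self
  have h2 := setIntegral_union (Set.Ioc_disjoint_Ioi le_rfl) measurableSet_Ioi h1
    (h b (ha.trans hab)).1
  rw [Set.Ioc_union_Ioi_eq_Ioi hab, (h a ha).2, (h b (ha.trans hab)).2] at h2
  linarith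

end HasTail

lemma hasTail_pow_mul_exp (i : ℕ) {L : ℝ} (hL : 0 < L) :
    HasTail (fun x => x ^ i * Real.exp (-L * x)) (expTail i L) := by
  intro a ha
  have hd : ∀ x ∈ Set.Ici a, HasDerivAt (fun x => -expTail i L x) (x ^ i * Real.exp (-L * x)) x :=
    fun x _ => by simpa using (hasDerivAt_expTail i hL x).fun_neg
  have ht : Filter.Tendsto (fun x => -expTail i L x) Filter.atTop (nhds 0) := by
    simpa using (tendsto_expTail i hL).neg
  have hi : IntegrableOn (fun x => x ^ i * Real.exp (-L * x)) (Set.Ioi a) :=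
    integrableOn_Ioi_deriv_of_nonneg' hd (fun x hx => by
      have : 0 < x := ha.trans_lt hx
      positivity) ht
  refine ⟨hi, ?_⟩
  rw [integral_Ioi_of_hasDerivAt_of_tendsto' hd hi ht]
  ring

lemma expTail_one (i : ℕ) (a : ℝ) :
    expTail i 1 a =
      (i ! : ℕ) * ∑ l ∈ Finset.range (i + 1), Real.exp (-a) * (a ^ l / (l ! : ℕ)) := by
  simp only [expTail, one_pow, div_one, one_mul, neg_mul]
  rw [mul_assoc, Finset.mul_sum]

/-- The tail integral of `y ^ j * exp (-y) * ∫_{T (c + y)}^∞ x ^ i * exp (-x) dx`. -/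
def tailThreshold (c T : ℝ) (i j : ℕ) (a : ℝ) : ℝ :=
  (i ! : ℕ) * ∑ l ∈ Finset.range (i + 1), Real.exp (-(T * c)) * (T ^ l / (l ! : ℕ)) *
    ∑ v ∈ Finset.range (l + 1), (l.choose v : ℝ) * c ^ (l - v) * expTail (j + v) (T + 1) a

/-- The tail integral of `y ^ j * exp (-y) * ∫_{y / k}^∞ x ^ i * exp (-x) dx`. -/
def tailRay (k : ℝ) (i j : ℕ) (a : ℝ) : ℝ :=
  (i ! : ℕ) * ∑ l ∈ Finset.range (i + 1), 1 / (k ^ l * (l ! : ℕ)) * expTail (j + l) ((k + 1) / k) a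

lemma hasTail_tailThreshold (c : ℝ) {T : ℝ} (hT : 0 < T) (i j : ℕ) :
    HasTail (fun y => y ^ j * Real.exp (-y) * expTail i 1 (T * (c + y)))
      (tailThreshold c T i j) := by
  refine HasTail.congr (HasTail.const_mul (HasTail.sum _ fun l _ => HasTail.const_mul
    (HasTail.sum _ fun v _ => HasTail.const_mul (hasTail_pow_mul_exp (j + v) (by positivity :
      0 < T + 1)) _) _) _) fun y _ => ?_
  rw [expTail_one, mul_left_comm]
  congr 1
  rw [Finset.mul_sum]
  refine Finset.sum_congr rfl fun l _ => ?_
  have he : Real.exp (-(T * (c + y))) * Real.exp (-y) =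
      Real.exp (-(T * c)) * Real.exp (-(T + 1) * y) := by
    rw [← Real.exp_add, ← Real.exp_add]
    ring_nf
  rw [mul_pow, add_comm c y, add_pow]
  have : ∑ v ∈ Finset.range (l + 1), (l.choose v : ℝ) * c ^ (l - v) *
      (y ^ (j + v) * Real.exp (-(T + 1) * y)) =
      (∑ v ∈ Finset.range (l + 1), y ^ v * c ^ (l - v) * (l.choose v : ℝ)) *
        (y ^ j * Real.exp (-(T + 1) * y)) := by
    rw [Finset.sum_mul]
    refine Finset.sum_congr rfl fun v _ => ?_
    ring
  rw [this, add_comm y c]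
  linear_combination (y ^ j * (T ^ l * (∑ v ∈ Finset.range (l + 1),
    y ^ v * c ^ (l - v) * (l.choose v : ℝ)) / (l ! : ℕ))) * he

lemma hasTail_tailRay {k : ℝ} (hk : 0 < k) (i j : ℕ) :
    HasTail (fun y => y ^ j * Real.exp (-y) * expTail i 1 (y / k)) (tailRay k i j) := by
  refine HasTail.congr (HasTail.const_mul (HasTail.sum _ fun l _ => HasTail.const_mul
    (hasTail_pow_mul_exp (j + l) (by positivity : 0 < (k + 1) / k)) _) _) fun y _ => ?_
  rw [expTail_one, mul_left_comm]
  congr 1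
  rw [Finset.mul_sum]
  refine Finset.sum_congr rfl fun l _ => ?_
  have he : Real.exp (-((k + 1) / k) * y) = Real.exp (-(y / k)) * Real.exp (-y) := by
    rw [← Real.exp_add]
    congr 1
    field_simp
    ring
  rw [he, div_pow]
  field_simp
  ring

/-! ### Decomposition into strips -/

/-- The part of the region `T (c + y) < x`, `0 < y`, in which `y / x` lies in `(k, k + 1]`. -/
def strip (c T : ℝ) (k : ℕ) : Set (ℝ × ℝ) :=
  {p | (0 < p.2 ∧ T * (c + p.2) < p.1) ∧ k * p.1 < p.2 ∧ p.2 ≤ (k + 1) * p.1}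

lemma measurableSet_strip (c T : ℝ) (k : ℕ) : MeasurableSet (strip c T k) := by
  simp only [strip, Set.ofPred_and]
  refine ((measurableSet_lt ?_ ?_).inter (measurableSet_lt ?_ ?_)).inter
    ((measurableSet_lt ?_ ?_).inter (measurableSet_le ?_ ?_)) <;> fun_prop

lemma strip_subset {c T : ℝ} (hc : 0 < c) (hT : 0 < T) (k : ℕ) :
    strip c T k ⊆ Set.Ioi 0 ×ˢ Set.Ioi 0 := by
  rintro ⟨x, y⟩ ⟨⟨hy, hx⟩, -⟩
  exact ⟨lt_trans (mul_pos hT (add_pos hc hy)) hx, hy⟩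

lemma pairwise_disjoint_strip {c T : ℝ} (hc : 0 < c) (hT : 0 < T) :
    Pairwise (Function.onFun Disjoint (strip c T)) := by
  have key : ∀ a b : ℕ, a < b → Disjoint (strip c T a) (strip c T b) := by
    intro a b hab
    refine Set.disjoint_left.2 fun p ha hb => ?_
    have hx : 0 < p.1 := (strip_subset hc hT a ha).1
    have h1 : p.2 ≤ (a + 1) * p.1 := ha.2.2
    have h2 : b * p.1 < p.2 := hb.2.1
    have h3 : (a + 1 : ℝ) ≤ b := by exact_mod_cast hab
    nlinarith
  intro a b hab
  rcases lt_or_gt_of_ne hab with h | h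
  · exact key a b h
  · exact (key b a h).symm

/-- As `y < x / T`, only the first `⌈1 / T⌉` strips are non-empty. -/
lemma region_eq_iUnion_strip {c T : ℝ} (hc : 0 < c) (hT : 0 < T) {m : ℕ} (hm : 1 ≤ m * T) :
    {p : ℝ × ℝ | 0 < p.2 ∧ T * (c + p.2) < p.1} = ⋃ k ∈ Finset.range m, strip c T k := by
  ext ⟨x, y⟩
  simp only [Set.mem_iUnion, Finset.mem_range, exists_prop]
  constructor
  · rintro ⟨hy, hxy⟩
    have hx : 0 < x := lt_trans (mul_pos hT (add_pos hc hy)) hxy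
    have hpos : 0 < ⌈y / x⌉₊ := Nat.ceil_pos.2 (div_pos hy hx)
    have h1 : y / x ≤ ⌈y / x⌉₊ := Nat.le_ceil _
    have h2 : (⌈y / x⌉₊ : ℝ) < y / x + 1 := Nat.ceil_lt_add_one (div_pos hy hx).le
    obtain ⟨k, hk⟩ : ∃ k, ⌈y / x⌉₊ = k + 1 := ⟨_, (Nat.succ_pred_eq_of_pos hpos).symm⟩
    rw [hk] at h1 h2
    push_cast at h1 h2
    rw [div_le_iff₀ hx] at h1
    have h3 : k * x < y := by rwa [add_lt_add_iff_right, lt_div_iff₀ hx] at h2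
    refine ⟨k, ?_, ⟨hy, hxy⟩, h3, h1⟩
    by_contra hkm
    have h4 : (m : ℝ) ≤ k := by exact_mod_cast not_lt.1 hkm
    have h5 : T * (c + y) < x := hxy
    have h6 : m * (T * (c + y)) < m * x ∨ m = 0 := by
      rcases Nat.eq_zero_or_pos m with h | h
      · exact .inr h
      · exact .inl (by gcongr)
    rcases h6 with h6 | rfl
    · nlinarith [mul_le_mul_of_nonneg_right h4 hx.le,
        mul_le_mul_of_nonneg_right hm (add_pos hc hy).le]
    · norm_num at hm
  · rintro ⟨k, -, h⟩
    exact h.1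

/-- In the `k`-th strip the truncated powers with `t ≤ k` are ordinary powers and the others vanish.
The strip may have `k > n + 1`; the binomial coefficients with `t > n + 1` are then zero. -/
lemma boundedSumDensity_of_mem_strip (n : ℕ) {c T : ℝ} (hc : 0 < c) (hT : 0 < T) {k : ℕ}
    {p : ℝ × ℝ} (hp : p ∈ strip c T k) :
    boundedSumDensity n p.1 p.2 =
      (∑ t ∈ Finset.range (k + 1), (-1) ^ t * ((n + 1).choose t : ℝ) * (p.2 - t * p.1) ^ n) /
        n ! := by
  have hx : 0 < p.1 := (strip_subset hc hT k hp).1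
  rw [boundedSumDensity]
  congr 1
  -- Both sums are extended by zeros to a common range.
  have h1 : ∑ t ∈ Finset.range (n + 2), (-1) ^ t * ((n + 1).choose t : ℝ) *
      posPow n (p.2 - t * p.1) = ∑ t ∈ Finset.range (n + 2 + (k + 1)),
        (-1) ^ t * ((n + 1).choose t : ℝ) * posPow n (p.2 - t * p.1) := by
    refine Finset.sum_subset (Finset.range_mono (by omega)) fun t _ ht => ?_
    rw [Nat.choose_eq_zero_of_lt (not_lt.1 (Finset.mem_range.not.1 ht))]
    simp
  have h2 : ∑ t ∈ Finset.range (k + 1), (-1) ^ t * ((n + 1).choose t : ℝ) *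
      posPow n (p.2 - t * p.1) = ∑ t ∈ Finset.range (n + 2 + (k + 1)),
        (-1) ^ t * ((n + 1).choose t : ℝ) * posPow n (p.2 - t * p.1) := by
    refine Finset.sum_subset (Finset.range_mono (by omega)) fun t _ ht => ?_
    have hkt : (k + 1 : ℝ) ≤ t := by exact_mod_cast (by simpa using ht : k + 1 ≤ t)
    have := hp.2.2
    rw [posPow_of_nonpos n (by nlinarith), mul_zero]
  rw [h1, ← h2]
  refine Finset.sum_congr rfl fun t ht => ?_
  have htk : (t : ℝ) ≤ k := by exact_mod_cast (by simpa [Nat.lt_succ_iff] using ht : t ≤ k)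
  have := hp.2.1
  rw [posPow_of_pos n (by nlinarith)]

lemma integrableOn_quadrant (i j : ℕ) :
    IntegrableOn (fun p : ℝ × ℝ => p.1 ^ i * Real.exp (-1 * p.1) * (p.2 ^ j * Real.exp (-1 * p.2)))
      (Set.Ioi 0 ×ˢ Set.Ioi 0) := by
  rw [IntegrableOn, Measure.volume_eq_prod, ← Measure.prod_restrict]
  exact (hasTail_pow_mul_exp i one_pos 0 le_rfl).1.mul_prod
    (hasTail_pow_mul_exp j one_pos 0 le_rfl).1

/-- The integral of `x ^ i * y ^ j * exp (-x - y)` over the `k`-th strip. -/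
def stripMoment (c T : ℝ) (k i j : ℕ) : ℝ :=
  ∫ p in strip c T k, p.1 ^ i * Real.exp (-1 * p.1) * (p.2 ^ j * Real.exp (-1 * p.2))

/-- The coverage probability of a single antenna in terms of the moments of the strips. -/
lemma pi_coverSet_eq_sum_stripMoment (n : ℕ) {c T : ℝ} (hc : 0 < c) (hT : 0 < T) {m : ℕ}
    (hm : 1 ≤ m * T) :
    (Measure.pi fun _ : Fin (n + 2) => stdExp).real (coverSet (n + 2) c T) =
      ∑ k ∈ Finset.range m, ((n + 2 : ℕ) : ℝ) / n ! *
        ∑ t ∈ Finset.range (k + 1), ((n + 1).choose t : ℝ) * (-1) ^ t *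
          ∑ i ∈ Finset.range (n + 1), (n.choose i : ℝ) * (-(t : ℝ)) ^ i *
            stripMoment c T k i (n - i) := by
  set f : ℝ × ℝ → ℝ := fun p => Real.exp (-(p.1 + p.2)) * boundedSumDensity n p.1 p.2
  have hint : ∀ k i j, IntegrableOn (fun p : ℝ × ℝ =>
      p.1 ^ i * Real.exp (-1 * p.1) * (p.2 ^ j * Real.exp (-1 * p.2))) (strip c T k) :=
    fun k i j => (integrableOn_quadrant i j).mono_set (strip_subset hc hT k)
  have hf : ∀ k, Set.EqOn f (fun p => 1 / (n ! : ℝ) * ∑ t ∈ Finset.range (k + 1),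
      ((n + 1).choose t : ℝ) * (-1) ^ t * ∑ i ∈ Finset.range (n + 1),
        (n.choose i : ℝ) * (-(t : ℝ)) ^ i *
          (p.1 ^ i * Real.exp (-1 * p.1) * (p.2 ^ (n - i) * Real.exp (-1 * p.2))))
      (strip c T k) := by
    intro k p hp
    simp only [f]
    rw [boundedSumDensity_of_mem_strip n hc hT hp, Finset.sum_div, Finset.mul_sum, Finset.mul_sum]
    refine Finset.sum_congr rfl fun t _ => ?_
    rw [show p.2 - t * p.1 = -(t : ℝ) * p.1 + p.2 by ring, add_pow, neg_add, Real.exp_add,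
      Finset.mul_sum, Finset.sum_div, Finset.mul_sum, Finset.mul_sum, Finset.mul_sum]
    refine Finset.sum_congr rfl fun i _ => ?_
    simp only [neg_one_mul, mul_pow]
    ring
  have hfint : ∀ k, IntegrableOn f (strip c T k) := fun k => by
    refine IntegrableOn.congr_fun ?_ (hf k).symm (measurableSet_strip c T k)
    exact (integrable_finsetSum _ fun t _ => (integrable_finsetSum _ fun i _ =>
      (hint k i (n - i)).const_mul _).const_mul _).const_mul _
  have hval : ∀ k, ∫ p in strip c T k, f p = 1 / (n ! : ℝ) * ∑ t ∈ Finset.range (k + 1),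
      ((n + 1).choose t : ℝ) * (-1) ^ t * ∑ i ∈ Finset.range (n + 1),
        (n.choose i : ℝ) * (-(t : ℝ)) ^ i * stripMoment c T k i (n - i) := by
    intro k
    rw [setIntegral_congr_fun (measurableSet_strip c T k) (hf k), integral_const_mul,
      integral_finsetSum _ fun t _ => (integrable_finsetSum _ fun i _ =>
      (hint k i (n - i)).const_mul _).const_mul _]
    congr 1
    refine Finset.sum_congr rfl fun t _ => ?_
    rw [integral_const_mul, integral_finsetSum _ fun i _ => (hint k i (n - i)).const_mul _]
    congr 1
    refine Finset.sum_congr rfl fun i _ => ?_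
    rw [integral_const_mul, stripMoment]
  have hnn : ∀ k, ∀ᵐ p ∂(volume.restrict (strip c T k)), 0 ≤ f p := fun k => by
    filter_upwards [ae_restrict_mem (measurableSet_strip c T k)] with p hp
    exact mul_nonneg (Real.exp_pos _).le
      (boundedSumDensity_nonneg n (le_of_lt (strip_subset hc hT k hp).1) _)
  rw [measureReal_def, pi_coverSet_eq_lintegral n hc hT, region_eq_iUnion_strip hc hT hm,
    lintegral_biUnion_finset ((pairwise_disjoint_strip hc hT).set_pairwise _)
      fun k _ => measurableSet_strip c T k, ENNReal.toReal_mul, ENNReal.toReal_natCast,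
    ENNReal.toReal_sum fun k _ =>
      (lintegral_ofReal_ne_top_iff_integrable (hfint k).1 (hnn k)).2 (hfint k), Finset.mul_sum]
  refine Finset.sum_congr rfl fun k _ => ?_
  rw [← ofReal_integral_eq_lintegral_ofReal (hfint k) (hnn k),
    ENNReal.toReal_ofReal (integral_nonneg_of_ae (hnn k)), hval k]
  ring

/-- Fubini, integrating over the strongest power first. -/
lemma stripMoment_eq {c T : ℝ} (hc : 0 < c) (hT : 0 < T) (k i j : ℕ) :
    stripMoment c T k i j = ∫ y in Set.Ioi 0, y ^ j * Real.exp (-y) *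
      ∫ x in {x | (x, y) ∈ strip c T k}, x ^ i * Real.exp (-1 * x) := by
  have hs := measurableSet_strip c T k
  have hi := (integrableOn_quadrant i j).mono_set (strip_subset hc hT k)
  rw [stripMoment, ← integral_indicator hs, Measure.volume_eq_prod, integral_prod_symm]
  · rw [← integral_indicator measurableSet_Ioi]
    congr 1
    ext y
    by_cases hy : y ∈ Set.Ioi (0 : ℝ)
    · have hsec : MeasurableSet {x | (x, y) ∈ strip c T k} := hs.preimage measurable_prodMk_right
      rw [Set.indicator_of_mem hy, ← integral_indicator hsec, ← integral_const_mul]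
      congr 1
      ext x
      by_cases hx : (x, y) ∈ strip c T k
      · simp [hx]
        ring
      · simp [hx]
    · rw [Set.indicator_of_notMem hy]
      refine integral_eq_zero_of_ae (.of_forall fun x => Set.indicator_of_notMem ?_ _)
      exact fun h => hy h.1.1
  · rw [← Measure.volume_eq_prod]
    exact (integrable_indicator_iff hs).2 hi

/-! ### Moments of the strips -/

/-- The value of `y` at which `y / k = T (c + y)`. -/
def cutoff (c T k : ℝ) : ℝ := T * c / (1 / k - T)

lemma cutoff_pos {c T k : ℝ} (hc : 0 < c) (hT : 0 < T) (hk : 0 < k) (hkT : k * T < 1) :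
    0 < cutoff c T k := by
  have : T < 1 / k := by rwa [lt_div_iff₀ hk, mul_comm]
  exact div_pos (mul_pos hT hc) (sub_pos.2 this)

lemma le_cutoff_iff {c T k y : ℝ} (hk : 0 < k) (hkT : k * T < 1) :
    y ≤ cutoff c T k ↔ y / k ≤ T * (c + y) := by
  have : T < 1 / k := by rwa [lt_div_iff₀ hk, mul_comm]
  rw [cutoff, le_div_iff₀ (sub_pos.2 this)]
  have : y * (1 / k - T) = y / k - T * y := by ring
  rw [this, mul_add]
  constructor <;> intro h <;> linarith

lemma cutoff_le_cutoff {c T k l : ℝ} (hc : 0 < c) (hT : 0 < T) (hk : 0 < k) (hkl : k ≤ l)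
    (hlT : l * T < 1) : cutoff c T k ≤ cutoff c T l := by
  have : T < 1 / l := by rwa [lt_div_iff₀ (hk.trans_le hkl), mul_comm]
  unfold cutoff
  have h1 : 0 < 1 / l - T := sub_pos.2 this
  gcongr

lemma integral_Ioi_expTail (i : ℕ) {a : ℝ} (ha : 0 ≤ a) :
    ∫ x in Set.Ioi a, x ^ i * Real.exp (-1 * x) = expTail i 1 a :=
  (hasTail_pow_mul_exp i one_pos a ha).2

lemma integral_Ico_expTail (i : ℕ) {a b : ℝ} (ha : 0 ≤ a) (hab : a ≤ b) :
    ∫ x in Set.Ico a b, x ^ i * Real.exp (-1 * x) = expTail i 1 a - expTail i 1 b := by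
  rw [integral_Ico_eq_integral_Ioo, ← integral_Ioc_eq_integral_Ioo,
    (hasTail_pow_mul_exp i one_pos).integral_Ioc ha hab]

lemma integral_Ioo_expTail (i : ℕ) {a b : ℝ} (ha : 0 ≤ a) (hab : a ≤ b) :
    ∫ x in Set.Ioo a b, x ^ i * Real.exp (-1 * x) = expTail i 1 a - expTail i 1 b := by
  rw [← integral_Ico_eq_integral_Ioo, integral_Ico_expTail i ha hab]

/-- An integral over `(0, ∞)` of a function that vanishes up to `a`, agrees with `f` on `(a, b]`
and with `g` beyond `b`. -/
lemma integral_Ioi_piecewise {f g F G h : ℝ → ℝ} {a b : ℝ} (hf : HasTail f F) (hg : HasTail g G)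
    (ha : 0 ≤ a) (hab : a ≤ b) (h0 : ∀ y, 0 < y → y ≤ a → h y = 0)
    (h1 : ∀ y, a < y → y ≤ b → h y = f y) (h2 : ∀ y, b < y → h y = g y) :
    ∫ y in Set.Ioi 0, h y = F a - F b + G b := by
  have e0 : Set.EqOn h 0 (Set.Ioc 0 a) := fun y hy => h0 y hy.1 hy.2
  have e1 : Set.EqOn h f (Set.Ioc a b) := fun y hy => h1 y hy.1 hy.2
  have e2 : Set.EqOn h g (Set.Ioi b) := fun y hy => h2 y hy
  have i0 : IntegrableOn h (Set.Ioc 0 a) :=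
    IntegrableOn.congr_fun (integrableOn_zero) e0.symm measurableSet_Ioc
  have i1 : IntegrableOn h (Set.Ioc a b) := IntegrableOn.congr_fun
    ((hf a ha).1.mono_set Set.Ioc_subset_Ioi_self) e1.symm measurableSet_Ioc
  have i2 : IntegrableOn h (Set.Ioi b) :=
    IntegrableOn.congr_fun (hg b (ha.trans hab)).1 e2.symm measurableSet_Ioi
  rw [← Set.Ioc_union_Ioi_eq_Ioi ha, ← Set.Ioc_union_Ioi_eq_Ioi hab,
    setIntegral_union _ (measurableSet_Ioc.union measurableSet_Ioi) i0 (i1.union i2),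
    setIntegral_union (Set.Ioc_disjoint_Ioi le_rfl) measurableSet_Ioi i1 i2,
    setIntegral_congr_fun measurableSet_Ioc e0, setIntegral_congr_fun measurableSet_Ioc e1,
    setIntegral_congr_fun measurableSet_Ioi e2, hf.integral_Ioc ha hab, (hg b (ha.trans hab)).2]
  · simp
  · rw [Set.Ioc_union_Ioi_eq_Ioi hab]
    exact Set.Ioc_disjoint_Ioi le_rfl

/-- In the strip `y ≤ x` the lower limit for `x` is `T (c + y)` up to the cutoff `b₁`, and `y`
beyond it. -/
lemma stripMoment_zero {c T : ℝ} (hc : 0 < c) (hT : 0 < T) (hT1 : T < 1) (i j : ℕ) :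
    stripMoment c T 0 i j = tailThreshold c T i j 0 - tailThreshold c T i j (cutoff c T 1) +
      tailRay 1 i j (cutoff c T 1) := by
  have hkT : 1 * T < 1 := by linarith
  rw [stripMoment_eq hc hT]
  refine integral_Ioi_piecewise (hasTail_tailThreshold c hT i j) (hasTail_tailRay one_pos i j)
    le_rfl (cutoff_pos hc hT one_pos hkT).le (fun y h h' => absurd h h'.not_gt) ?_ ?_
  · intro y hy hyb
    have h1 := (le_cutoff_iff one_pos hkT).1 hyb
    have hs : {x | (x, y) ∈ strip c T 0} = Set.Ioi (T * (c + y)) := by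
      ext x
      simp only [strip, Set.mem_ofPred_eq, Set.mem_Ioi, Nat.cast_zero]
      constructor
      · exact fun h => h.1.2
      · exact fun h => ⟨⟨hy, h⟩, by linarith, by linarith⟩
    rw [hs, integral_Ioi_expTail i (by positivity)]
  · intro y hyb
    have hy : 0 < y := (cutoff_pos hc hT one_pos hkT).trans hyb
    have h1 := (le_cutoff_iff (c := c) one_pos hkT).not.1 hyb.not_ge
    have hs : {x | (x, y) ∈ strip c T 0} = Set.Ici (y / 1) := by
      ext x
      simp only [strip, Set.mem_ofPred_eq, Set.mem_Ici, Nat.cast_zero]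
      constructor
      · exact fun h => by linarith [h.2.2]
      · exact fun h => ⟨⟨hy, by linarith⟩, by linarith, by linarith⟩
    rw [hs, integral_Ici_eq_integral_Ioi, integral_Ioi_expTail i (by positivity)]

/-- Up to the cutoff `b_k` the `k`-th strip lies below the threshold. -/
lemma section_strip_of_le {c T y : ℝ} {k : ℕ} (hk : 0 < k) (hkT : k * T < 1)
    (hy : y ≤ cutoff c T k) : {x | (x, y) ∈ strip c T k} = ∅ := by
  have hk' : (0 : ℝ) < k := by exact_mod_cast hk
  have h1 := (le_cutoff_iff hk' hkT).1 hy
  refine Set.eq_empty_of_forall_notMem fun x hx => ?_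
  have h2 : (k : ℝ) * x < y := hx.2.1
  have h3 : T * (c + y) < x := hx.1.2
  have h4 : x < y / k := by rwa [lt_div_iff₀' hk']
  linarith

/-- When the ray `y = (k + 1) x` lies below the threshold, the latter is the lower limit for `x`. -/
lemma section_strip_of_threshold {c T y : ℝ} {k : ℕ} (hk : 0 < k) (hy : 0 < y)
    (hyk : y / (k + 1) ≤ T * (c + y)) :
    {x | (x, y) ∈ strip c T k} = Set.Ioo (T * (c + y)) (y / k) := by
  have hk' : (0 : ℝ) < k := by exact_mod_cast hk
  rw [div_le_iff₀' (by positivity)] at hyk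
  ext x
  simp only [strip, Set.mem_ofPred_eq, Set.mem_Ioo, lt_div_iff₀' hk']
  constructor
  · exact fun h => ⟨h.1.2, h.2.1⟩
  · exact fun h => ⟨⟨hy, h.1⟩, h.2, by nlinarith⟩

/-- An intermediate strip: `x` runs up to `y / k`, from `T (c + y)` between the cutoffs `b_k` and
`b_{k+1}` and from `y / (k + 1)` beyond them. -/
lemma stripMoment_mid {c T : ℝ} (hc : 0 < c) (hT : 0 < T) {k : ℕ} (hk : 0 < k)
    (hkT : (k + 1) * T < 1) (i j : ℕ) :
    stripMoment c T k i j =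
      (tailThreshold c T i j (cutoff c T k) - tailRay k i j (cutoff c T k)) -
        (tailThreshold c T i j (cutoff c T (k + 1)) - tailRay k i j (cutoff c T (k + 1))) +
      (tailRay (k + 1) i j (cutoff c T (k + 1)) - tailRay k i j (cutoff c T (k + 1))) := by
  have hk' : (0 : ℝ) < k := by exact_mod_cast hk
  have hk1 : (0 : ℝ) < k + 1 := by positivity
  have hkT' : k * T < 1 := by nlinarith
  have hb := cutoff_pos hc hT hk' hkT'
  have hbb := cutoff_le_cutoff hc hT hk' (by linarith : (k : ℝ) ≤ k + 1) hkT
  rw [stripMoment_eq hc hT]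
  refine integral_Ioi_piecewise
    ((hasTail_tailThreshold c hT i j).sub (hasTail_tailRay hk' i j))
    ((hasTail_tailRay hk1 i j).sub (hasTail_tailRay hk' i j)) hb.le hbb ?_ ?_ ?_
  · intro y _ hyb
    rw [section_strip_of_le hk hkT' hyb]
    simp
  · intro y hby hyb
    have hy := hb.trans hby
    have h1 := (le_cutoff_iff (c := c) hk' hkT').not.1 hby.not_ge
    rw [section_strip_of_threshold hk hy ((le_cutoff_iff hk1 hkT).1 hyb),
      integral_Ioo_expTail i (by positivity) (by linarith)]
    ring
  · intro y hby
    have hy := (hb.trans_le hbb).trans hby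
    have h1 := (le_cutoff_iff (c := c) hk1 hkT).not.1 hby.not_ge
    have hs : {x | (x, y) ∈ strip c T k} = Set.Ico (y / (k + 1)) (y / k) := by
      ext x
      simp only [strip, Set.mem_ofPred_eq, Set.mem_Ico, lt_div_iff₀' hk', div_le_iff₀' hk1]
      constructor
      · exact fun h => ⟨h.2.2, h.2.1⟩
      · refine fun h => ⟨⟨hy, ?_⟩, h.2, h.1⟩
        have : y / (k + 1) ≤ x := by rw [div_le_iff₀' hk1]; exact h.1
        linarith
    rw [hs, integral_Ico_expTail i (by positivity) (by gcongr; linarith)]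
    ring

/-- In the last strip the lower limit for `x` is always `T (c + y)`. -/
lemma stripMoment_last {c T : ℝ} (hc : 0 < c) (hT : 0 < T) {k : ℕ} (hk : 0 < k)
    (hkT : k * T < 1) (hkT' : 1 ≤ (k + 1) * T) (i j : ℕ) :
    stripMoment c T k i j =
      tailThreshold c T i j (cutoff c T k) - tailRay k i j (cutoff c T k) := by
  have hk' : (0 : ℝ) < k := by exact_mod_cast hk
  have hb := cutoff_pos hc hT hk' hkT
  have hF := (hasTail_tailThreshold c hT i j).sub (hasTail_tailRay hk' i j)
  have key : ∀ y, cutoff c T k < y → y ^ j * Real.exp (-y) *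
      ∫ x in {x | (x, y) ∈ strip c T k}, x ^ i * Real.exp (-1 * x) =
      y ^ j * Real.exp (-y) * expTail i 1 (T * (c + y)) -
        y ^ j * Real.exp (-y) * expTail i 1 (y / k) := by
    intro y hby
    have hy := hb.trans hby
    have h1 := (le_cutoff_iff (c := c) hk' hkT).not.1 hby.not_ge
    rw [section_strip_of_threshold hk hy (by
        rw [div_le_iff₀' (by positivity)]
        nlinarith [mul_pos hT hc]),
      integral_Ioo_expTail i (by positivity) (by linarith)]
    ring
  rw [stripMoment_eq hc hT]
  refine (integral_Ioi_piecewise hF hF hb.le le_rfl ?_ (fun y h _ => key y h) key).trans (by ring)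
  intro y _ hyb
  rw [section_strip_of_le hk hkT hyb]
  simp

/-! ### The closed form -/

lemma cutoff_eq_b (N : ℕ) (ρ T : ℝ) (k : ℕ) : cutoff (N / ρ) T k = b N ρ T k := by
  rw [cutoff, b, ← mul_div_assoc, div_div]

/-- The operator `ξ`, with `t` shifted to start at `0`, as the strips are. -/
lemma xi_eq_sum_range (n k : ℕ) (g : ℕ → ℕ → ℝ) :
    xi (n + 2) (k + 1) g = ((n + 2 : ℕ) : ℝ) / n ! *
      ∑ t ∈ Finset.range (k + 1), ((n + 1).choose t : ℝ) * (-1) ^ t *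
        ∑ i ∈ Finset.range (n + 1), (n.choose i : ℝ) * (-(t : ℝ)) ^ i *
          ((i ! : ℕ) * ∑ l ∈ Finset.range (i + 1), g i l) := by
  rw [xi]
  congr 1
  rw [← Finset.Ico_add_one_right_eq_Icc, ← Finset.sum_Ico_add' _ 0 (k + 1) 1]
  refine Finset.sum_congr (Finset.range_eq_Ico _).symm fun t _ => ?_
  congr 1
  · rw [show n + 2 - 1 = n + 1 by omega, Nat.add_sub_cancel, pow_succ, pow_succ]
    ring
  · refine Finset.sum_congr rfl fun i _ => ?_
    rw [mul_assoc (_ * _)]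
    congr 3
    push_cast
    ring

lemma xi_add (N p : ℕ) (g h : ℕ → ℕ → ℝ) :
    xi N p g + xi N p h = xi N p fun i l => g i l + h i l := by
  simp only [xi, Finset.sum_add_distrib, mul_add]

lemma D₁_eq {n i : ℕ} (hi : i ≤ n) (ρ T : ℝ) (k l : ℕ) :
    D₁ (n + 2) ρ T (k + 1) i l = ∑ v ∈ Finset.range (l + 1),
      (l.choose v : ℝ) * (((n + 2 : ℕ) : ℝ) / ρ) ^ (l - v) *
        (expTail (n - i + v) (T + 1) (b (n + 2) ρ T k) -
          expTail (n - i + v) (T + 1) (b (n + 2) ρ T (k + 1))) := by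
  refine Finset.sum_congr rfl fun v _ => ?_
  rw [show n + 2 - i + v - 2 = n - i + v by omega, show n + 2 - i + v - 1 = n - i + v + 1 by omega,
    Nat.add_sub_cancel, expTail, expTail, Finset.mul_sum, Finset.mul_sum, Finset.mul_sum,
    ← Finset.sum_sub_distrib, Finset.mul_sum]
  refine Finset.sum_congr rfl fun u _ => ?_
  ring

lemma F₁_eq {n i : ℕ} (hi : i ≤ n) (ρ T : ℝ) (k l : ℕ) :
    F₁ (n + 2) ρ T (k + 1) i l = ∑ v ∈ Finset.range (l + 1),
      (l.choose v : ℝ) * (((n + 2 : ℕ) : ℝ) / ρ) ^ (l - v) *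
        expTail (n - i + v) (T + 1) (b (n + 2) ρ T k) := by
  refine Finset.sum_congr rfl fun v _ => ?_
  rw [show n + 2 - i + v - 2 = n - i + v by omega, show n + 2 - i + v - 1 = n - i + v + 1 by omega,
    Nat.add_sub_cancel, expTail]
  simp only [mul_assoc]

lemma E₁_eq {n i : ℕ} (hi : i ≤ n) (ρ T : ℝ) (k l : ℕ) :
    E₁ (n + 2) ρ T k i l = expTail (n - i + l) (((k : ℝ) + 1) / k) (b (n + 2) ρ T k) := by
  rw [E₁, show n + 2 - i + l - 2 = n - i + l by omega,
    show n + 2 - i + l - 1 = n - i + l + 1 by omega, expTail]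

lemma E₂_eq {n i : ℕ} (hi : i ≤ n) (ρ T : ℝ) (k l : ℕ) :
    E₂ (n + 2) ρ T (k + 1) i l =
      expTail (n - i + l) (((k : ℝ) + 1) / k) (b (n + 2) ρ T (k + 1)) := by
  rw [E₂, show n + 2 - i + l - 2 = n - i + l by omega,
    show n + 2 - i + l - 1 = n - i + l + 1 by omega, expTail]
  push_cast
  rw [add_sub_cancel_right]

lemma F₂_eq {n i : ℕ} (hi : i ≤ n) (ρ T : ℝ) (k l : ℕ) :
    F₂ (n + 2) ρ T (k + 1) i l =
      expTail (n - i + l) (((k : ℝ) + 1) / k) (b (n + 2) ρ T k) := by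
  rw [F₂, show n + 2 - i + l - 2 = n - i + l by omega,
    show n + 2 - i + l - 1 = n - i + l + 1 by omega, expTail, Nat.add_sub_cancel]
  push_cast
  rw [add_sub_cancel_right]

lemma D₂_eq {n i : ℕ} (hi : i ≤ n) (ρ T : ℝ) (k l : ℕ) :
    D₂ (n + 2) ρ T (k + 1) i l =
      expTail (n - i + l) (((k : ℝ) + 1) / k) (b (n + 2) ρ T k) -
        expTail (n - i + l) (((k : ℝ) + 1) / k) (b (n + 2) ρ T (k + 1)) := by
  rw [D₂, show n + 2 - i + l - 2 = n - i + l by omega,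
    show n + 2 - i + l - 1 = n - i + l + 1 by omega, expTail, expTail, Nat.add_sub_cancel]
  push_cast
  rw [add_sub_cancel_right]
  ring

lemma expTail_zero_right (i : ℕ) (L : ℝ) : expTail i L 0 = (i ! : ℕ) / L ^ (i + 1) := by
  rw [expTail, Finset.sum_eq_single 0]
  · simp
  · intro u _ hu
    simp [hu]
  · simp

lemma sum_stripMoment_zero (n : ℕ) {ρ T : ℝ} (hρ : 0 < ρ) (hT : 0 < T) (hT1 : T < 1) :
    ((n + 2 : ℕ) : ℝ) / n ! *
        ∑ t ∈ Finset.range 1, ((n + 1).choose t : ℝ) * (-1) ^ t *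
          ∑ i ∈ Finset.range (n + 1), (n.choose i : ℝ) * (-(t : ℝ)) ^ i *
            stripMoment ((n + 2 : ℕ) / ρ) T 0 i (n - i) = pFirst (n + 2) ρ T := by
  have hc : 0 < ((n + 2 : ℕ) : ℝ) / ρ := by positivity
  -- Only `t = 0` occurs in the first strip, and `0 ^ i` leaves only `i = 0`.
  rw [pFirst, Finset.sum_range_one, Finset.sum_eq_single 0]
  · have hb := cutoff_eq_b (n + 2) ρ T 1
    rw [Nat.cast_one] at hb
    rw [stripMoment_zero hc hT hT1, hb]
    simp only [tailThreshold, tailRay, Finset.sum_range_one, zero_add]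
    simp only [Nat.choose_zero_right, Nat.factorial_zero, pow_zero, Nat.cast_one, Nat.sub_zero,
      add_zero, mul_one, one_mul, div_one, Nat.add_sub_cancel, mul_div_assoc, Nat.choose_self]
    rw [expTail_zero_right, C₁, C₂]
    simp only [expTail, Nat.add_sub_cancel, show n + 2 - 1 = n + 1 by omega]
    norm_num
    left
    simp only [mul_div_assoc]
    ring
  · intro i _ hi
    simp [hi]
  · simp

lemma sum_stripMoment_mid (n : ℕ) {ρ T : ℝ} (hρ : 0 < ρ) (hT : 0 < T) {k : ℕ} (hk : 0 < k)
    (hkT : (k + 1) * T < 1) :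
    ((n + 2 : ℕ) : ℝ) / n ! *
        ∑ t ∈ Finset.range (k + 1), ((n + 1).choose t : ℝ) * (-1) ^ t *
          ∑ i ∈ Finset.range (n + 1), (n.choose i : ℝ) * (-(t : ℝ)) ^ i *
            stripMoment ((n + 2 : ℕ) / ρ) T k i (n - i) = pMid (n + 2) ρ T (k + 1) := by
  have hc : 0 < ((n + 2 : ℕ) : ℝ) / ρ := by positivity
  -- The two applications of `ξ` are combined, and compared with the moments term by term.
  rw [pMid, xi_add, xi_eq_sum_range]
  congr 1
  refine Finset.sum_congr rfl fun t _ => ?_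
  congr 1
  refine Finset.sum_congr rfl fun i hi => ?_
  have hin : i ≤ n := by simpa [Nat.lt_succ_iff] using hi
  congr 1
  have hb := cutoff_eq_b (n + 2) ρ T (k + 1)
  push_cast at hb
  rw [stripMoment_mid hc hT hk hkT]
  push_cast
  rw [hb, ← Nat.cast_two, ← Nat.cast_add, cutoff_eq_b]
  simp only [tailThreshold, tailRay, ← mul_sub, ← mul_add, ← Finset.sum_sub_distrib,
    ← Finset.sum_add_distrib]
  congr 1
  refine Finset.sum_congr rfl fun l _ => ?_
  rw [D₁_eq hin, D₂_eq hin, E₁_eq hin, E₂_eq hin]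
  simp only [mul_sub, Finset.sum_sub_distrib, mul_div_assoc]
  push_cast
  simp only [add_sub_cancel_right]
  ring

lemma sum_stripMoment_last (n : ℕ) {ρ T : ℝ} (hρ : 0 < ρ) (hT : 0 < T) {k : ℕ} (hk : 0 < k)
    (hkT : k * T < 1) (hkT' : 1 ≤ (k + 1) * T) :
    ((n + 2 : ℕ) : ℝ) / n ! *
        ∑ t ∈ Finset.range (k + 1), ((n + 1).choose t : ℝ) * (-1) ^ t *
          ∑ i ∈ Finset.range (n + 1), (n.choose i : ℝ) * (-(t : ℝ)) ^ i *
            stripMoment ((n + 2 : ℕ) / ρ) T k i (n - i) = pLast (n + 2) ρ T (k + 1) := by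
  have hc : 0 < ((n + 2 : ℕ) : ℝ) / ρ := by positivity
  rw [pLast, xi_eq_sum_range]
  congr 1
  refine Finset.sum_congr rfl fun t _ => ?_
  congr 1
  refine Finset.sum_congr rfl fun i hi => ?_
  have hin : i ≤ n := by simpa [Nat.lt_succ_iff] using hi
  congr 1
  rw [stripMoment_last hc hT hk hkT hkT', cutoff_eq_b]
  simp only [tailThreshold, tailRay, ← mul_sub, ← Finset.sum_sub_distrib]
  congr 1
  refine Finset.sum_congr rfl fun l _ => ?_
  rw [F₁_eq hin, F₂_eq hin]
  push_cast
  simp only [add_sub_cancel_right, mul_div_assoc]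

/-- For `T < 1` the successive strips contribute the successive summands. -/
lemma pi_coverSet_of_lt_one (n : ℕ) {ρ T : ℝ} (hρ : 0 < ρ) (hT : 0 < T) (hT1 : T < 1) :
    (Measure.pi fun _ : Fin (n + 2) => stdExp).real (coverSet (n + 2) ((n + 2 : ℕ) / ρ) T) =
      pLow (n + 2) ρ T := by
  have hc : 0 < ((n + 2 : ℕ) : ℝ) / ρ := by positivity
  have h2 : 1 < ⌈1 / T⌉₊ := by
    rw [Nat.lt_ceil, Nat.cast_one]
    exact (one_lt_div hT).2 hT1
  obtain ⟨k, hk⟩ : ∃ k, ⌈1 / T⌉₊ = k + 2 := ⟨_, (Nat.sub_add_cancel h2).symm⟩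
  have hle : 1 / T ≤ (k + 2 : ℕ) := hk ▸ Nat.le_ceil _
  have hlt : ((k + 1 : ℕ) : ℝ) < 1 / T := Nat.lt_ceil.1 (by omega)
  rw [div_le_iff₀ hT] at hle
  rw [lt_div_iff₀ hT] at hlt
  rw [pi_coverSet_eq_sum_stripMoment n hc hT hle, pLow, hk, Finset.sum_range_succ,
    Finset.sum_range_succ', add_comm (Finset.sum _ _),
    sum_stripMoment_last n hρ hT k.succ_pos hlt (by push_cast at hle ⊢; linarith)]
  rw [sum_stripMoment_zero n hρ hT hT1]
  congr 2
  rw [show k + 2 - 1 = k + 1 by omega, ← Finset.Ico_add_one_right_eq_Icc]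
  refine Eq.trans ?_ (Finset.sum_Ico_add' (pMid (n + 2) ρ T) 0 k 2)
  refine Finset.sum_congr (Finset.range_eq_Ico _) fun j hj => ?_
  have hjk : (j : ℝ) + 1 ≤ k := by exact_mod_cast (Finset.mem_Ico.1 hj).2
  push_cast at hlt
  exact sum_stripMoment_mid n hρ hT j.succ_pos (by push_cast; nlinarith)

end ORP

end

theorem theorem2 {Ω : Type*} [MeasurableSpace Ω] (μ : Measure Ω) [IsProbabilityMeasure μ]
    (Nr Nt N : ℕ) (hNr : 1 ≤ Nr) (hN : 1 ≤ N)
    (PT σ2 T : ℝ) (hPT : 0 < PT) (hσ2 : 0 < σ2) (hT : 0 < T)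
    (H : Ω → Matrix (Fin Nr) (Fin Nt) ℂ) (P : Ω → Matrix (Fin Nt) (Fin N) ℂ)
    -- the entries of the channel matrix are i.i.d. `CN(0, 1)`
    (hHlaw : ∀ r j, HasLaw (fun ω => H ω r j) (ORP.complexGaussian 1) μ)
    (hHindep : iIndepFun (fun (q : Fin Nr × Fin Nt) ω => H ω q.1 q.2) μ)
    -- the precoding matrix is random, with orthonormal columns
    (hPmeas : ∀ j n, AEMeasurable (fun ω => P ω j n) μ)
    (hPorth : ∀ᵐ ω ∂μ, (P ω)ᴴ * P ω = 1)
    -- the channel and the precoding matrix are independent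
    (hHP : IndepFun (fun ω (q : Fin Nr × Fin Nt) => H ω q.1 q.2)
      (fun ω (q : Fin Nt × Fin N) => P ω q.1 q.2) μ) :
    (1 ≤ T → ORP.coverageProb μ PT σ2 H P T = 1 - (1 - ORP.pHigh N (PT / σ2) T) ^ Nr) ∧
    (T < 1 → 2 ≤ N →
      ORP.coverageProb μ PT σ2 H P T = 1 - (1 - ORP.pLow N (PT / σ2) T) ^ Nr) := by
  have hlaw := ORP.hasLaw_mul_precoder hHlaw hHindep hPmeas hPorth hHP
  rw [ORP.coverageProb_eq hNr hN T hPT hσ2 hlaw]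
  have hρ : 0 < PT / σ2 := div_pos hPT hσ2
  refine ⟨fun hT1 => ?_, fun hT1 hN2 => ?_⟩
  · obtain ⟨n, rfl⟩ : ∃ n, N = n + 1 := ⟨_, (Nat.sub_add_cancel hN).symm⟩
    rw [ORP.pi_coverSet_of_one_le n (by positivity) hT1, ORP.pHigh, Nat.add_sub_cancel,
      mul_div_assoc]
    push_cast
    rfl
  · obtain ⟨n, rfl⟩ : ∃ n, N = n + 2 := ⟨_, (Nat.sub_add_cancel hN2).symm⟩
    rw [ORP.pi_coverSet_of_lt_one n hρ hT hT1]
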